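/- A closed curve of length $T>0$ is a $T$-periodic $C^2$ map $\gamma:\mathbb R\to\mathbb R^2$ parametrized by arc length, $|\dot\gamma|=1$; $\kappa_\gamma$ denotes its oriented curvature. On the closed curves of length $2\pi$ consider the functional $$U(\gamma)=\int_0^{2\pi}\kappa_\gamma(t)^2\,dt .$$ Call such a $\gamma$ critical if $\frac{d}{dh}\big|_{h=0}U(\gamma_h)=0$ for every family $(\gamma_h)_{|h|<\varepsilon}$ of closed curves of length $2\pi$ with $\gamma_0=\gamma$ which is continuously differentiable in $h$ in the $C^2$ sense (that is, $\partial_h\partial_t^j\gamma_h(t)$ exists and is jointly continuous in $(h,t)$ for $j=0,1,2$). For continuous $\alpha:\mathbb R\to\mathbb R$ put $\gamma_\alpha(t)=\int_0^t(\cos\alpha,\sin\alpha)\,ds$; $\alpha$ is a Gauss representation of $\gamma$ if $\dot\gamma=(\cos\alpha,\sin\alpha)$. Say that $\alpha$ gives a closed differentiable curve if $\int_0^{2\pi}\cos\alpha\,dt=\int_0^{2\pi}\sin\alpha\,dt=0$ and $\alpha(2\pi)-\alpha(0)\in2\pi\mathbb Z$. A closed curve of length $T$ is a circle (passed once) if it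 is injective on $[0,T)$ and its image is a circle. It is $\infty$-shaped (passed once) if there are $a<b<a+T$ and a unit vector $n$ such that: $\gamma(a)=\gamma(b)=:c$ is its only self-intersection, i.e. $\gamma(s)=\gamma(t)$ with $s\ne t$ in $[a,a+T)$ only for $\{s,t\}=\{a,b\}$; $\dot\gamma(a),\dot\gamma(b)$ are linearly independent; $\langle n,\gamma-c\rangle$ is positive on $(a,b)$ and negative on $(b,a+T)$; $\kappa_\gamma$ has no zeros on these two intervals and has opposite signs on them; and the image of $\gamma$ is symmetric about the line through $c$ along $n$ and about the line through $c$ orthogonal to $n$. A closed curve of length $2\pi$ is a circle (resp. an $\infty$-shaped curve) passed several times if for some integer $k\ge1$ it is $2\pi/k$-periodic and, as a closed curve of length $2\pi/k$, a circle (resp. $\infty$-shaped) passed once. **Theorem.** 1. Let $\gamma$ be a critical closed curve of length $2\pi$. Then for some $\omega\ge0$ a suitable rotation of $\gamma$ has a $C^2$ Gauss representation $\alpha$ satisfying the pendulum equation $\ddot\alpha+\omega^2\sin\alpha=0$, and either $\omega=0$ and $\gamma$ is a circle passed several times, or $\omega>0$, $\gamma$ is an $\infty$-shaped curve passed several times,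 and $\sin\frac{\alpha(t)}2=\xi\,\mathrm{sn}(\omega t+t_0\,|\,\xi)$ for some $\xi\in(0,1)$ and $t_0\in\mathbb R$, where $\mathrm{sn}(u|m)=\sin\varphi$ with $u=\int_0^{\varphi}\frac{ds}{\sqrt{1-m^2\sin^2s}}$. 2. Let $\omega\ge0$ and let $\alpha:\mathbb R\to\mathbb R$ be a $C^2$ solution of $\ddot\alpha+\omega^2\sin\alpha=0$ that gives a closed differentiable curve. Then either $\omega=0$ and $\gamma_\alpha$ is a circle passed several times, or $\omega>0$, $\gamma_\alpha$ is an $\infty$-shaped curve passed several times, and $\sin\frac{\alpha(t)}2=\xi\,\mathrm{sn}(\omega t+t_0\,|\,\xi)$ for some $\xi\in(0,1)$ and $t_0\in\mathbb R$. 3. Let $\omega>0$ and let $\alpha:\mathbb R\to\mathbb R$ be a solution of $\ddot\alpha+\omega^2\sin\alpha=0$, with energy $E=\frac12\dot\alpha^2-\omega^2\cos\alpha$. If $\alpha$ is an equilibrium ($\alpha$ constant), a separatrix ($E=\omega^2$, $\alpha$ not constant) or a full rotation ($E>\omega^2$), then it does not give a closed differentiable curve. -/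

import Mathlib

open scoped ComplexConjugate
open Set

noncomputable section

namespace PlaneCurve

/-- A closed regular `C²` curve of length `T > 0` in the plane `ℂ = ℝ²`, parametrized by arc length
and extended to the line as a `T`-periodic map. -/
structure IsClosedCurve (γ : ℝ → ℂ) (T : ℝ) : Prop where
  length_pos : 0 < T
  contDiff : ContDiff ℝ 2 γ
  periodic : Function.Periodic γ T
  unit_speed : ∀ t, ‖deriv γ t‖ = 1

/-- Oriented curvature `det (γ', γ'') / |γ'|³`. -/
def curvature (γ : ℝ → ℂ) (t : ℝ) : ℝ :=
  (conj (deriv γ t) * deriv (deriv γ) t).im / ‖deriv γ t‖ ^ 3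

/-- The uniformization functional `U_f`, on closed curves of length `2π` with arc length
parameter. -/
def uniformization (f : ℝ → ℝ) (γ : ℝ → ℂ) : ℝ :=
  ∫ t in (0 : ℝ)..(2 * Real.pi), f (curvature γ t)

/-- `Γ h`, `|h| < ε`, is a variation of `γ` through closed `C²` curves of length `2π`, continuously
differentiable in `h` with respect to the `C²` topology: `Γ h` and its first two derivatives in the
arc length parameter have derivatives in `h` that are jointly continuous. -/
structure IsVariation (γ : ℝ → ℂ) (ε : ℝ) (Γ : ℝ → ℝ → ℂ) : Prop where
  pos : 0 < ε
  start : Γ 0 = γ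
  closed : ∀ h ∈ Ioo (-ε) ε, IsClosedCurve (Γ h) (2 * Real.pi)
  smooth : ∀ j ≤ 2, ∃ D : ℝ → ℝ → ℂ,
    ContinuousOn (Function.uncurry D) (Ioo (-ε) ε ×ˢ univ) ∧
    ∀ h ∈ Ioo (-ε) ε, ∀ t, HasDerivAt (fun s => iteratedDeriv j (Γ s) t) (D h t) h

/-- `γ` is a critical point of `U_f` on the space of closed regular `C²` curves of length `2π`. -/
def IsCritical (f : ℝ → ℝ) (γ : ℝ → ℂ) : Prop :=
  IsClosedCurve γ (2 * Real.pi) ∧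
    ∀ (ε : ℝ) (Γ : ℝ → ℝ → ℂ), IsVariation γ ε Γ →
      HasDerivAt (fun h => uniformization f (Γ h)) 0 0

/-- `α` is a Gauss representation of `γ`: `γ' = (cos α, sin α)`. -/
def IsGaussRep (γ : ℝ → ℂ) (α : ℝ → ℝ) : Prop :=
  Continuous α ∧ ∀ t, HasDerivAt γ (Real.cos (α t) + Real.sin (α t) * Complex.I) t

/-- The curve `γ_α`, starting at the origin, with Gauss representation `α`. -/
def curveOf (α : ℝ → ℝ) (t : ℝ) : ℂ :=
  ∫ s in (0 : ℝ)..t, ((Real.cos (α s) : ℂ) + Real.sin (α s) * Complex.I)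

/-- The arc of `γ_α` over `[0, 2π]` is a closed differentiable curve: it ends where it starts and
its tangent vectors at the two ends coincide. -/
def ClosesUp (α : ℝ → ℝ) : Prop :=
  (∫ t in (0 : ℝ)..(2 * Real.pi), Real.cos (α t)) = 0 ∧
  (∫ t in (0 : ℝ)..(2 * Real.pi), Real.sin (α t)) = 0 ∧
  ∃ k : ℤ, α (2 * Real.pi) = α 0 + 2 * Real.pi * k

/-- Solutions of the pendulum equation `α̈ + ω² sin α = 0`. -/
def IsPendulum (ω : ℝ) (α : ℝ → ℝ) : Prop :=
  ContDiff ℝ 2 α ∧ ∀ t, deriv (deriv α) t + ω ^ 2 * Real.sin (α t) = 0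

/-- Energy of the pendulum; it is constant along solutions, and equals `ω²` at the unstable
equilibrium. -/
def energy (ω : ℝ) (α : ℝ → ℝ) (t : ℝ) : ℝ :=
  deriv α t ^ 2 / 2 - ω ^ 2 * Real.cos (α t)

def IsEquilibrium (α : ℝ → ℝ) : Prop := ∀ t, α t = α 0

/-- Nonconstant motions on the energy level of the unstable equilibrium. -/
def IsSeparatrix (ω : ℝ) (α : ℝ → ℝ) : Prop :=
  (∀ t, energy ω α t = ω ^ 2) ∧ ¬ IsEquilibrium α

/-- Full swing motions: the energy exceeds that of the unstable equilibrium. -/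
def IsFullRotation (ω : ℝ) (α : ℝ → ℝ) : Prop :=
  ∀ t, ω ^ 2 < energy ω α t

/-- Incomplete elliptic integral of the first kind with modulus `m`. -/
def ellipticF (m φ : ℝ) : ℝ :=
  ∫ s in (0 : ℝ)..φ, 1 / Real.sqrt (1 - m ^ 2 * Real.sin s ^ 2)

/-- `s = sn (u | m)`: `s = sin φ` for a solution `φ` of `u = F(φ, m)`
(for `|m| < 1` there is exactly one). -/
def IsJacobiSn (m u s : ℝ) : Prop :=
  ∃ φ : ℝ, ellipticF m φ = u ∧ s = Real.sin φ

/-- Swings that are not full: `sin (α / 2) = ξ sn (ω t + t₀ | ξ)` with modulus `0 < ξ < 1`. -/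
def IsEllipticSwing (ω : ℝ) (α : ℝ → ℝ) : Prop :=
  ∃ ξ ∈ Ioo (0 : ℝ) 1, ∃ t₀ : ℝ, ∀ t, ∃ s : ℝ,
    IsJacobiSn ξ (ω * t + t₀) s ∧ Real.sin (α t / 2) = ξ * s

/-- A circle passed once by a closed curve of length `T`. -/
def IsCircle (γ : ℝ → ℂ) (T : ℝ) : Prop :=
  IsClosedCurve γ T ∧ InjOn γ (Ico 0 T) ∧
    ∃ (c : ℂ) (R : ℝ), 0 < R ∧ range γ = Metric.sphere c R

/-- An `∞`-shaped curve of length `T`, passed once. It has exactly one self-intersection, a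
transversal double point `c = γ a = γ b`. A line through `c` (orthogonal to the unit vector `n`)
strictly separates the two lobes, which are bent in opposite directions, and the curve is symmetric
about both axes of the `∞` (the lines through `c` along `n` and orthogonal to `n`). -/
def IsInfinityShaped (γ : ℝ → ℂ) (T : ℝ) : Prop :=
  IsClosedCurve γ T ∧
  ∃ (a b : ℝ) (n : ℂ), a < b ∧ b < a + T ∧ ‖n‖ = 1 ∧
    γ a = γ b ∧
    (∀ s ∈ Ico a (a + T), ∀ t ∈ Ico a (a + T), γ s = γ t →
      s = t ∨ (s = a ∧ t = b) ∨ (s = b ∧ t = a)) ∧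
    LinearIndependent ℝ ![deriv γ a, deriv γ b] ∧
    (∀ t ∈ Ioo a b, 0 < (conj n * (γ t - γ a)).re) ∧
    (∀ t ∈ Ioo b (a + T), (conj n * (γ t - γ a)).re < 0) ∧
    (((∀ t ∈ Ioo a b, 0 < curvature γ t) ∧ ∀ t ∈ Ioo b (a + T), curvature γ t < 0) ∨
      ((∀ t ∈ Ioo a b, curvature γ t < 0) ∧ ∀ t ∈ Ioo b (a + T), 0 < curvature γ t)) ∧
    (∀ t, ∃ s, γ s = γ a + n ^ 2 * conj (γ t - γ a)) ∧
    (∀ t, ∃ s, γ s = γ a - n ^ 2 * conj (γ t - γ a))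

/-- A closed curve of length `2π` is a curve of type `P` and length `2π / k`, passed `k ≥ 1`
times. -/
def PassedSeveralTimes (P : (ℝ → ℂ) → ℝ → Prop) (γ : ℝ → ℂ) : Prop :=
  ∃ k : ℕ, 1 ≤ k ∧ P γ (2 * Real.pi / k)

end PlaneCurve

end

open PlaneCurve

open scoped ComplexConjugate
open Set

noncomputable section

namespace PlaneCurve

/-! Critical curves obey the pendulum equation. Write the tangent as `exp (iα)`, so that the
curvature is `α'`. A periodic `η` with `∫ η cos α = ∫ η sin α = 0` preserves closedness to first
order, and the implicit function theorem corrects it to a genuine variation (`exists_closing_path`),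
so criticality gives `∫ α' η' = 0`. Let `ζ` be the part of `α'` that is `L²`-orthogonal to `1`, `x`
and `y`. By parts, its primitive is such an `η`, hence `∫ ζ² = 0` and `α' = a + b x + c y`.
Differentiating gives `α'' = b cos α + c sin α`, a pendulum after a rotation.

For `ω = 0` the angle is linear and the curve is a circle. For `ω > 0` and energy at least `ω²`, a
motion that is not an equilibrium never comes to rest. Then `sin α / α'` has derivative `cos α + (ω
sin α / α')²`; integrating over a closed curve gives `sin α = 0`, a contradiction. Only the swings
`2 arcsin (ξ sn)` remain.

In terms of the amplitude `φ`, a swing draws, up to scale and rigid motion, the curve `(X φ, -2 ξ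
cos φ)` with `X' = 2Δ - 1/Δ`. Closing up forces `φ` to advance by a multiple of `2π` and `X π = 0`.
Then `X` is odd, `π`-periodic and strictly concave on `[0, π/2]`, so it vanishes only at multiples
of `π/2`. This leaves a single double point; the symmetries of `X` and `cos` give the two axes of
the `∞`. -/

/-- The delta amplitude `√(1 - m² sin² s)` of modulus `m`, as a function of the amplitude. -/
def deltaAmplitude (m s : ℝ) : ℝ := Real.sqrt (1 - m ^ 2 * Real.sin s ^ 2)

/-! ### Elliptic integrals, the Jacobi amplitude and the zeros of the abscissa -/

section Elliptic

variable {m : ℝ}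

theorem one_sub_sq_mul_sin_sq_pos (hm : m ∈ Ioo (0 : ℝ) 1) (s : ℝ) :
    0 < 1 - m ^ 2 * Real.sin s ^ 2 := by
  have h1 : Real.sin s ^ 2 ≤ 1 := Real.sin_sq_le_one s
  have h2 : m ^ 2 < 1 := by nlinarith [hm.1, hm.2]
  nlinarith [sq_nonneg m, sq_nonneg (Real.sin s)]

theorem deltaAmplitude_pos (hm : m ∈ Ioo (0 : ℝ) 1) (s : ℝ) : 0 < deltaAmplitude m s :=
  Real.sqrt_pos.2 (one_sub_sq_mul_sin_sq_pos hm s)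

theorem deltaAmplitude_sq (hm : m ∈ Ioo (0 : ℝ) 1) (s : ℝ) :
    deltaAmplitude m s ^ 2 = 1 - m ^ 2 * Real.sin s ^ 2 :=
  Real.sq_sqrt (one_sub_sq_mul_sin_sq_pos hm s).le

theorem deltaAmplitude_le_one (m s : ℝ) : deltaAmplitude m s ≤ 1 :=
  Real.sqrt_le_one.2 (by nlinarith [sq_nonneg (m * Real.sin s)])

theorem continuous_deltaAmplitude (m : ℝ) : Continuous (deltaAmplitude m) := by
  unfold deltaAmplitude; fun_prop

theorem deltaAmplitude_add_pi (m s : ℝ) :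
    deltaAmplitude m (s + Real.pi) = deltaAmplitude m s := by
  simp [deltaAmplitude, Real.sin_add_pi]

theorem deltaAmplitude_neg (m s : ℝ) : deltaAmplitude m (-s) = deltaAmplitude m s := by
  simp [deltaAmplitude]

theorem continuous_inv_deltaAmplitude (hm : m ∈ Ioo (0 : ℝ) 1) :
    Continuous fun s => 1 / deltaAmplitude m s :=
  continuous_const.div (continuous_deltaAmplitude m) fun s => (deltaAmplitude_pos hm s).ne'

theorem hasDerivAt_ellipticF (hm : m ∈ Ioo (0 : ℝ) 1) (φ : ℝ) :
    HasDerivAt (ellipticF m) (1 / deltaAmplitude m φ) φ :=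
  (continuous_inv_deltaAmplitude hm).integral_hasStrictDerivAt 0 φ |>.hasDerivAt

theorem strictMono_ellipticF (hm : m ∈ Ioo (0 : ℝ) 1) : StrictMono (ellipticF m) :=
  strictMono_of_hasDerivAt_pos (hasDerivAt_ellipticF hm)
    fun φ => one_div_pos.2 (deltaAmplitude_pos hm φ)

theorem ellipticF_zero (m : ℝ) : ellipticF m 0 = 0 := by simp [ellipticF]

/-- The integrand is at least 1. Comparison with the identity makes the elliptic integral unbounded
in both directions, hence surjective. -/
theorem monotone_ellipticF_sub_id (hm : m ∈ Ioo (0 : ℝ) 1) :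
    Monotone fun φ => ellipticF m φ - φ := by
  refine monotone_of_hasDerivAt_nonneg (fun φ => (hasDerivAt_ellipticF hm φ).sub (hasDerivAt_id φ))
    fun φ => ?_
  have := (one_le_div (deltaAmplitude_pos hm φ)).2 (deltaAmplitude_le_one m φ)
  simpa using this

theorem continuous_ellipticF (hm : m ∈ Ioo (0 : ℝ) 1) : Continuous (ellipticF m) :=
  continuous_iff_continuousAt.2 fun φ => (hasDerivAt_ellipticF hm φ).continuousAt

theorem surjective_ellipticF (hm : m ∈ Ioo (0 : ℝ) 1) : Function.Surjective (ellipticF m) := by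
  refine (continuous_ellipticF hm).surjective ?_ ?_
  · refine Filter.tendsto_atTop_mono' _ ?_ Filter.tendsto_id
    filter_upwards [Filter.eventually_ge_atTop (0 : ℝ)] with φ hφ
    have := monotone_ellipticF_sub_id hm hφ
    simp only [ellipticF_zero] at this
    simp only [id]; linarith
  · refine Filter.tendsto_atBot_mono' _ ?_ Filter.tendsto_id
    filter_upwards [Filter.eventually_le_atBot (0 : ℝ)] with φ hφ
    have := monotone_ellipticF_sub_id hm hφ
    simp only [ellipticF_zero] at this
    simp only [id]; linarith

/-- A function with `π`-periodic derivative grows by a constant over each interval of length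
`π`. -/
theorem add_pi_eq_of_hasDerivAt {G g : ℝ → ℝ} (hG : ∀ x, HasDerivAt G (g x) x)
    (hg : ∀ x, g (x + Real.pi) = g x) (h0 : G 0 = 0) (x : ℝ) :
    G (x + Real.pi) = G x + G Real.pi := by
  have hd : ∀ y, HasDerivAt (fun x => G (x + Real.pi) - G x) 0 y := fun y => by
    have := ((hG (y + Real.pi)).comp_add_const y Real.pi).sub (hG y)
    rwa [hg, sub_self] at this
  have := is_const_of_deriv_eq_zero (fun y => (hd y).differentiableAt) (fun y => (hd y).deriv) x 0
  simp only [zero_add, h0] at this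
  linarith

theorem add_nat_mul_pi_eq {G : ℝ → ℝ} {p : ℝ} (hG : ∀ x, G (x + Real.pi) = G x + p) (x : ℝ)
    (n : ℕ) : G (x + n * Real.pi) = G x + n * p := by
  induction n with
  | zero => simp
  | succ n ih =>
    push_cast
    rw [add_one_mul, ← add_assoc, hG, ih]; ring

theorem ellipticF_add_pi (hm : m ∈ Ioo (0 : ℝ) 1) (φ : ℝ) :
    ellipticF m (φ + Real.pi) = ellipticF m φ + ellipticF m Real.pi :=
  add_pi_eq_of_hasDerivAt (hasDerivAt_ellipticF hm)
    (fun x => by rw [deltaAmplitude_add_pi]) (ellipticF_zero m) φ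

/-- The Jacobi amplitude, the inverse of the elliptic integral of the first kind. -/
def jacobiAm (m : ℝ) : ℝ → ℝ := Function.invFun (ellipticF m)

theorem ellipticF_jacobiAm (hm : m ∈ Ioo (0 : ℝ) 1) (u : ℝ) : ellipticF m (jacobiAm m u) = u :=
  Function.rightInverse_invFun (surjective_ellipticF hm) u

theorem jacobiAm_ellipticF (hm : m ∈ Ioo (0 : ℝ) 1) (φ : ℝ) : jacobiAm m (ellipticF m φ) = φ :=
  Function.leftInverse_invFun (strictMono_ellipticF hm).injective φ

theorem strictMono_jacobiAm (hm : m ∈ Ioo (0 : ℝ) 1) : StrictMono (jacobiAm m) := fun u v h => by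
  rwa [← (strictMono_ellipticF hm).lt_iff_lt, ellipticF_jacobiAm hm, ellipticF_jacobiAm hm]

theorem hasDerivAt_jacobiAm (hm : m ∈ Ioo (0 : ℝ) 1) (u : ℝ) :
    HasDerivAt (jacobiAm m) (deltaAmplitude m (jacobiAm m u)) u := by
  -- A monotone surjection is continuous, which the inverse function rule needs.
  have hc : Continuous (jacobiAm m) := (strictMono_jacobiAm hm).monotone.continuous_of_surjective
    fun φ => ⟨_, jacobiAm_ellipticF hm φ⟩
  have := HasDerivAt.of_local_left_inverse (a := u) hc.continuousAt (hasDerivAt_ellipticF hm _)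
    (one_div_pos.2 (deltaAmplitude_pos hm _)).ne'
    (Filter.Eventually.of_forall (ellipticF_jacobiAm hm))
  simpa using this

/-- The abscissa of the elastic curve of modulus `m` as a function of the amplitude. -/
def elasticAbscissa (m φ : ℝ) : ℝ :=
  ∫ s in (0 : ℝ)..φ, (2 * deltaAmplitude m s - 1 / deltaAmplitude m s)

theorem elasticAbscissa_zero (m : ℝ) : elasticAbscissa m 0 = 0 := by simp [elasticAbscissa]

theorem hasDerivAt_elasticAbscissa (hm : m ∈ Ioo (0 : ℝ) 1) (φ : ℝ) :
    HasDerivAt (elasticAbscissa m) (2 * deltaAmplitude m φ - 1 / deltaAmplitude m φ) φ :=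
  ((continuous_const.mul (continuous_deltaAmplitude m)).sub
    (continuous_inv_deltaAmplitude hm)).integral_hasStrictDerivAt 0 φ |>.hasDerivAt

theorem elasticAbscissa_add_pi (hm : m ∈ Ioo (0 : ℝ) 1) (φ : ℝ) :
    elasticAbscissa m (φ + Real.pi) = elasticAbscissa m φ + elasticAbscissa m Real.pi :=
  add_pi_eq_of_hasDerivAt (hasDerivAt_elasticAbscissa hm)
    (fun x => by rw [deltaAmplitude_add_pi]) (elasticAbscissa_zero m) φ

theorem elasticAbscissa_neg (m φ : ℝ) : elasticAbscissa m (-φ) = -elasticAbscissa m φ := by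
  have := intervalIntegral.integral_comp_neg (a := 0) (b := φ)
    (fun s => 2 * deltaAmplitude m s - 1 / deltaAmplitude m s)
  simp only [deltaAmplitude_neg, neg_zero] at this
  rw [elasticAbscissa, elasticAbscissa, intervalIntegral.integral_symm, this]

theorem strictAntiOn_deltaAmplitude (hm : m ∈ Ioo (0 : ℝ) 1) :
    StrictAntiOn (deltaAmplitude m) (Icc 0 (Real.pi / 2)) := by
  intro a ha b hb hab
  have hs : Real.sin a < Real.sin b :=
    Real.strictMonoOn_sin ⟨by linarith [ha.1, Real.pi_pos], ha.2⟩
      ⟨by linarith [hb.1, Real.pi_pos], hb.2⟩ hab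
  have h0 : 0 ≤ Real.sin a := Real.sin_nonneg_of_nonneg_of_le_pi ha.1 (by linarith [ha.2, Real.pi_pos])
  refine Real.sqrt_lt_sqrt (one_sub_sq_mul_sin_sq_pos hm b).le ?_
  have : m ^ 2 * Real.sin a ^ 2 < m ^ 2 * Real.sin b ^ 2 :=
    mul_lt_mul_of_pos_left (by nlinarith) (pow_pos hm.1 2)
  linarith

/-- The derivative `2Δ - 1/Δ` increases with `Δ`, and `Δ` decreases on the quarter period. -/
theorem strictConcaveOn_elasticAbscissa (hm : m ∈ Ioo (0 : ℝ) 1) :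
    StrictConcaveOn ℝ (Icc 0 (Real.pi / 2)) (elasticAbscissa m) := by
  refine StrictAntiOn.strictConcaveOn_of_deriv (convex_Icc _ _)
    (fun x _ => (hasDerivAt_elasticAbscissa hm x).continuousAt.continuousWithinAt) ?_
  intro a ha b hb hab
  rw [(hasDerivAt_elasticAbscissa hm a).deriv, (hasDerivAt_elasticAbscissa hm b).deriv]
  have h := strictAntiOn_deltaAmplitude hm (interior_subset ha) (interior_subset hb) hab
  have := one_div_lt_one_div_of_lt (deltaAmplitude_pos hm b) h
  linarith

/-- The modulus is such that the elastic curve is closed. -/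
def IsClosingModulus (m : ℝ) : Prop := m ∈ Ioo (0 : ℝ) 1 ∧ elasticAbscissa m Real.pi = 0

theorem IsClosingModulus.add_pi (hm : IsClosingModulus m) (φ : ℝ) :
    elasticAbscissa m (φ + Real.pi) = elasticAbscissa m φ := by
  rw [elasticAbscissa_add_pi hm.1, hm.2, add_zero]

/-- By oddness and `π`-periodicity the values at `-π/2` and `π/2` are both opposite and equal. -/
theorem IsClosingModulus.half_pi (hm : IsClosingModulus m) :
    elasticAbscissa m (Real.pi / 2) = 0 := by
  have h := hm.add_pi (-(Real.pi / 2))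
  rw [elasticAbscissa_neg, show -(Real.pi / 2) + Real.pi = Real.pi / 2 by ring] at h
  linarith

/-- A strictly concave function vanishing at both ends of an interval is positive inside. -/
theorem IsClosingModulus.pos (hm : IsClosingModulus m) {φ : ℝ} (hφ : φ ∈ Ioo 0 (Real.pi / 2)) :
    0 < elasticAbscissa m φ := by
  have hp := Real.pi_pos
  have h := (strictConcaveOn_elasticAbscissa hm.1).2
    (left_mem_Icc.2 (by positivity)) (right_mem_Icc.2 (by positivity))
    (show (0 : ℝ) ≠ Real.pi / 2 by positivity)
    (show 0 < 1 - φ / (Real.pi / 2) by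
      rw [sub_pos, div_lt_one (by positivity)]; exact hφ.2)
    (show 0 < φ / (Real.pi / 2) from div_pos hφ.1 (by positivity)) (by ring)
  simp only [elasticAbscissa_zero, hm.half_pi, smul_eq_mul, mul_zero, add_zero, zero_add] at h
  rwa [div_mul_cancel₀ _ (by positivity)] at h

/-- By Rolle, `2Δ² = 1` somewhere inside the quarter period, and `Δ` is smaller at its end `π/2`.
This makes the crossing at the double point transversal: `cos α = 2Δ² - 1` is nonzero there. -/
theorem IsClosingModulus.two_mul_one_sub_sq_lt_one (hm : IsClosingModulus m) :
    2 * (1 - m ^ 2) < 1 := by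
  have hp := Real.pi_pos
  have hD := deltaAmplitude_pos hm.1 (Real.pi / 2)
  obtain ⟨c, hc, h⟩ := exists_hasDerivAt_eq_slope (elasticAbscissa m) _
    (show (0 : ℝ) < Real.pi / 2 by positivity)
    (fun x _ => (hasDerivAt_elasticAbscissa hm.1 x).continuousAt.continuousWithinAt)
    (fun x _ => hasDerivAt_elasticAbscissa hm.1 x)
  rw [elasticAbscissa_zero, hm.half_pi, sub_self, zero_div] at h
  have hc' := deltaAmplitude_pos hm.1 c
  have h1 := strictAntiOn_deltaAmplitude hm.1 (Ioo_subset_Icc_self hc)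
    (right_mem_Icc.2 (by positivity)) hc.2
  have h2 : 2 * deltaAmplitude m c ^ 2 = 1 := by
    field_simp at h
    linarith
  have h3 := deltaAmplitude_sq hm.1 (Real.pi / 2)
  rw [Real.sin_pi_div_two, one_pow, mul_one] at h3
  nlinarith

/-- The zeros of the abscissa are the multiples of `π / 2`. -/
theorem IsClosingModulus.sin_eq_zero_or_cos_eq_zero (hm : IsClosingModulus m) {φ : ℝ}
    (h : elasticAbscissa m φ = 0) : Real.sin φ = 0 ∨ Real.cos φ = 0 := by
  have hp := Real.pi_pos
  have hper : Function.Periodic (elasticAbscissa m) Real.pi := hm.add_pi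
  obtain ⟨ψ, hψ, k, hk⟩ : ∃ ψ ∈ Ico (0 : ℝ) Real.pi, ∃ k : ℤ, φ = ψ + k * Real.pi := by
    refine ⟨toIcoMod hp 0 φ, ?_, toIcoDiv hp 0 φ, ?_⟩
    · simpa only [zero_add] using toIcoMod_mem_Ico hp 0 φ
    · simp
  have h' : elasticAbscissa m ψ = 0 := by
    rw [← h, hk]; exact ((hper.int_mul k) ψ).symm
  have key : ψ = 0 ∨ ψ = Real.pi / 2 := by
    by_contra hne
    push Not at hne
    rcases lt_or_gt_of_ne hne.2 with hl | hl
    · exact (hm.pos ⟨lt_of_le_of_ne hψ.1 (Ne.symm hne.1), hl⟩).ne' h'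
    -- Between `π/2` and `π`, reflect to `π - ψ`, where the abscissa is positive.
    · have := hm.pos (φ := -(ψ - Real.pi)) ⟨by linarith [hψ.2], by linarith⟩
      rw [elasticAbscissa_neg, hper.sub_eq, h'] at this
      simp at this
  rcases key with rfl | rfl
  · left; rw [hk, zero_add]; exact Real.sin_int_mul_pi k
  · right; rw [hk, Real.cos_add_int_mul_pi]; simp

end Elliptic

/-! ### Motions of the pendulum: which can close up, and their form -/

section Pendulum

variable {ω : ℝ} {α : ℝ → ℝ}

theorem IsPendulum.hasDerivAt (h : IsPendulum ω α) (t : ℝ) : HasDerivAt α (deriv α t) t :=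
  (h.1.differentiable (by norm_num) t).hasDerivAt

theorem IsPendulum.hasDerivAt_deriv (h : IsPendulum ω α) (t : ℝ) :
    HasDerivAt (deriv α) (-ω ^ 2 * Real.sin (α t)) t := by
  have hd : ContDiff ℝ 1 (deriv α) := ((contDiff_succ_iff_deriv (n := 1)).1 h.1).2.2
  have := (hd.differentiable (by norm_num) t).hasDerivAt
  rwa [show deriv (deriv α) t = -ω ^ 2 * Real.sin (α t) by linarith [h.2 t]] at this

theorem IsPendulum.continuous_deriv (h : IsPendulum ω α) : Continuous (deriv α) :=
  continuous_iff_continuousAt.2 fun t => (h.hasDerivAt_deriv t).continuousAt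

theorem IsPendulum.of_hasDerivAt {a : ℝ → ℝ} (h1 : ∀ t, HasDerivAt α (a t) t)
    (h2 : ∀ t, HasDerivAt a (-ω ^ 2 * Real.sin (α t)) t) : IsPendulum ω α := by
  have e1 : deriv α = a := funext fun t => (h1 t).deriv
  have e2 : deriv a = fun t => -ω ^ 2 * Real.sin (α t) := funext fun t => (h2 t).deriv
  have hc : Continuous α := continuous_iff_continuousAt.2 fun t => (h1 t).continuousAt
  refine ⟨(contDiff_succ_iff_deriv (n := 1)).2
    ⟨fun t => (h1 t).differentiableAt, by simp, ?_⟩, fun t => by rw [e1, e2]; ring⟩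
  rw [e1, contDiff_one_iff_deriv, e2]
  exact ⟨fun t => (h2 t).differentiableAt, by fun_prop⟩

theorem IsPendulum.energy_eq (h : IsPendulum ω α) (t : ℝ) : energy ω α t = energy ω α 0 := by
  have hd : ∀ s, HasDerivAt (energy ω α) 0 s := fun s => by
    have := (((h.hasDerivAt_deriv s).pow 2).div_const 2).sub
      (((h.hasDerivAt s).cos).const_mul (ω ^ 2))
    convert! this using 1
    simp; ring
  exact is_const_of_deriv_eq_zero (fun s => (hd s).differentiableAt) (fun s => (hd s).deriv) t 0

/-- Solutions of the pendulum equation are determined by position and velocity at time `0`. -/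
theorem IsPendulum.unique {β : ℝ → ℝ} (hα : IsPendulum ω α) (hβ : IsPendulum ω β)
    (h0 : α 0 = β 0) (h1 : deriv α 0 = deriv β 0) : α = β := by
  let v : ℝ → ℝ × ℝ → ℝ × ℝ := fun _ p => (p.2, -ω ^ 2 * Real.sin p.1)
  have hsin : LipschitzWith 1 Real.sin := by
    refine lipschitzWith_of_nnnorm_deriv_le Real.differentiable_sin fun x => ?_
    rw [Real.deriv_sin, ← NNReal.coe_le_coe]
    simpa using Real.abs_cos_le_one x
  have hlip : ∀ t, LipschitzOnWith (max 1 (‖-ω ^ 2‖₊ * (1 * 1))) (v t) univ := fun t =>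
    (LipschitzWith.prodMk (LipschitzWith.prod_snd)
      ((lipschitzWith_smul (-ω ^ 2)).comp (hsin.comp LipschitzWith.prod_fst))).lipschitzOnWith
  have := ODE_solution_unique_univ (f := fun t => (α t, deriv α t))
    (g := fun t => (β t, deriv β t)) (t₀ := 0) hlip
    (fun t => ⟨(hα.hasDerivAt t).prodMk (hα.hasDerivAt_deriv t), mem_univ _⟩)
    (fun t => ⟨(hβ.hasDerivAt t).prodMk (hβ.hasDerivAt_deriv t), mem_univ _⟩)
    (by simp [h0, h1])
  exact funext fun t => congrArg Prod.fst (congrFun this t)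

theorem isPendulum_const {c : ℝ} (hc : Real.sin c = 0) : IsPendulum ω fun _ => c :=
  .of_hasDerivAt (a := fun _ => 0) (fun t => hasDerivAt_const t c)
    fun t => by simpa [hc] using hasDerivAt_const t (0 : ℝ)

/-- Uniqueness, after moving time `t` to the origin, identifies the motion with a constant one. -/
theorem IsPendulum.isEquilibrium (h : IsPendulum ω α) {t : ℝ} (h1 : deriv α t = 0)
    (h2 : Real.sin (α t) = 0) : IsEquilibrium α := by
  have hs : IsPendulum ω fun s => α (s + t) :=
    .of_hasDerivAt (a := fun s => deriv α (s + t))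
      (fun s => (h.hasDerivAt (s + t)).comp_add_const s t)
      (fun s => (h.hasDerivAt_deriv (s + t)).comp_add_const s t)
  have hc := hs.unique (isPendulum_const h2) (by simp)
    (by simp [deriv_comp_add_const, h1])
  intro s
  have e1 := congrFun hc (s - t)
  have e2 := congrFun hc (0 - t)
  simp only [sub_add_cancel] at e1 e2
  rw [e1, e2]

theorem IsEquilibrium.not_closesUp (h : IsEquilibrium α) : ¬ ClosesUp α := by
  rintro ⟨h1, h2, -⟩
  have e : ∀ t, α t = α 0 := h
  simp only [e, intervalIntegral.integral_const, sub_zero, smul_eq_mul, mul_eq_zero,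
    OfNat.ofNat_ne_zero, Real.pi_ne_zero, or_self, false_or] at h1 h2
  have := Real.sin_sq_add_cos_sq (α 0)
  rw [h1, h2] at this
  norm_num at this

/-- The integral of `α''` is `-ω² ∫ sin α`, so the vertical closing condition returns the velocity
to its initial value. -/
theorem IsPendulum.deriv_add_two_pi (h : IsPendulum ω α) (hc : ClosesUp α) :
    deriv α (2 * Real.pi) = deriv α 0 := by
  have hcont := h.1.continuous
  have := intervalIntegral.integral_eq_sub_of_hasDerivAt
    (fun t _ => h.hasDerivAt_deriv t) (a := 0) (b := 2 * Real.pi)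
    ((by fun_prop : Continuous fun t => -ω ^ 2 * Real.sin (α t)).intervalIntegrable _ _)
  rw [intervalIntegral.integral_const_mul, hc.2.1] at this
  linarith

/-- A pendulum that never comes to rest gives no closed curve. -/
theorem IsPendulum.not_closesUp_of_deriv_ne_zero (hω : 0 < ω) (h : IsPendulum ω α)
    (hne : ∀ t, deriv α t ≠ 0) : ¬ ClosesUp α := by
  intro hc
  have hcont := h.1.continuous
  have hcont' := h.continuous_deriv
  -- This quotient takes equal values at the two ends and `cos α` integrates to zero, so the
  -- remaining square must integrate to zero.
  have hd : ∀ t, HasDerivAt (fun t => Real.sin (α t) / deriv α t)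
      (Real.cos (α t) + (ω * Real.sin (α t) / deriv α t) ^ 2) t := fun t => by
    convert! (h.hasDerivAt t).sin.div (h.hasDerivAt_deriv t) (hne t) using 1
    have := hne t
    field_simp
    ring
  have hi2 : Continuous fun t => (ω * Real.sin (α t) / deriv α t) ^ 2 :=
    ((continuous_const.mul (Real.continuous_sin.comp hcont)).div hcont' hne).pow 2
  have hi1 : Continuous fun t => Real.cos (α t) := Real.continuous_cos.comp hcont
  have hp : (0 : ℝ) < 2 * Real.pi := by positivity
  have h0 := intervalIntegral.integral_eq_sub_of_hasDerivAt (fun t _ => hd t)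
    (a := 0) (b := 2 * Real.pi) ((hi1.add hi2).intervalIntegrable _ _)
  obtain ⟨k, hk⟩ := hc.2.2
  rw [intervalIntegral.integral_add (hi1.intervalIntegrable _ _) (hi2.intervalIntegrable _ _),
    hc.1, zero_add, h.deriv_add_two_pi hc, hk, mul_comm (2 * Real.pi) (k : ℝ),
    Real.sin_add_int_mul_two_pi, sub_self] at h0
  have hz : ∀ t ∈ Icc 0 (2 * Real.pi), Real.sin (α t) = 0 := by
    intro t ht
    by_contra hs
    have : 0 < ∫ t in (0 : ℝ)..(2 * Real.pi), (ω * Real.sin (α t) / deriv α t) ^ 2 :=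
      intervalIntegral.integral_pos hp hi2.continuousOn (fun x _ => sq_nonneg _)
        ⟨t, ht, by have := hne t; positivity⟩
    exact this.ne' h0
  -- Near an interior time `sin α` vanishes identically, so `α' cos α = 0` with `cos α = ±1`,
  -- against `α' ≠ 0`.
  have hs : ∀ᶠ t in nhds Real.pi, Real.sin (α t) = 0 := by
    filter_upwards [Ioo_mem_nhds Real.pi_pos (by linarith : Real.pi < 2 * Real.pi)] with t ht
    exact hz t (Ioo_subset_Icc_self ht)
  have h1 : HasDerivAt (fun t => Real.sin (α t)) 0 Real.pi :=
    (hasDerivAt_const _ _).congr_of_eventuallyEq hs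
  have h2 := h1.unique (h.hasDerivAt Real.pi).sin
  have h3 := Real.sin_sq_add_cos_sq (α Real.pi)
  rw [hs.self_of_nhds] at h3
  rcases mul_eq_zero.1 h2.symm with h4 | h4
  · rw [h4] at h3; norm_num at h3
  · exact hne _ h4

/-- At this energy, rest is possible only where `cos α = -1`, that is, at the unstable equilibrium.
-/
theorem IsPendulum.not_closesUp (hω : 0 < ω) (h : IsPendulum ω α)
    (hE : ω ^ 2 ≤ energy ω α 0) : ¬ ClosesUp α := by
  by_cases heq : IsEquilibrium α
  · exact heq.not_closesUp
  refine h.not_closesUp_of_deriv_ne_zero hω fun t ht => heq (h.isEquilibrium ht ?_)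
  rw [← h.energy_eq t, energy, ht] at hE
  have h1 : Real.cos (α t) = -1 := by
    refine le_antisymm ?_ (Real.neg_one_le_cos _)
    nlinarith [pow_pos hω 2]
  have := Real.sin_sq_add_cos_sq (α t)
  rw [h1] at this
  nlinarith

/-- Equilibria, separatrices and full rotations give no closed curves. -/
theorem IsPendulum.not_closesUp_of_not_swing (hω : 0 < ω) (h : IsPendulum ω α)
    (hα : IsEquilibrium α ∨ IsSeparatrix ω α ∨ IsFullRotation ω α) : ¬ ClosesUp α := by
  rcases hα with h1 | h1 | h1
  · exact h1.not_closesUp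
  · exact h.not_closesUp hω (h1.1 0).ge
  · exact h.not_closesUp hω (h1 0).le

/-- The swing `2 arcsin (ξ sn (ω t + t₀ | ξ))` of the pendulum. -/
def pendulumSwing (ω ξ t₀ t : ℝ) : ℝ :=
  2 * Real.arcsin (ξ * Real.sin (jacobiAm ξ (ω * t + t₀)))

variable {ξ : ℝ}

theorem sin_half_pendulumSwing (hξ : ξ ∈ Ioo (0 : ℝ) 1) (ω t₀ t : ℝ) :
    Real.sin (pendulumSwing ω ξ t₀ t / 2) = ξ * Real.sin (jacobiAm ξ (ω * t + t₀)) := by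
  have h1 := Real.neg_one_le_sin (jacobiAm ξ (ω * t + t₀))
  have h2 := Real.sin_le_one (jacobiAm ξ (ω * t + t₀))
  rw [pendulumSwing, mul_div_cancel_left₀ _ two_ne_zero]
  exact Real.sin_arcsin (by nlinarith [hξ.1, hξ.2]) (by nlinarith [hξ.1, hξ.2])

theorem cos_half_pendulumSwing (ω ξ t₀ t : ℝ) :
    Real.cos (pendulumSwing ω ξ t₀ t / 2) = deltaAmplitude ξ (jacobiAm ξ (ω * t + t₀)) := by
  rw [pendulumSwing, mul_div_cancel_left₀ _ two_ne_zero, Real.cos_arcsin, deltaAmplitude, mul_pow]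

theorem cos_pendulumSwing (ω ξ t₀ t : ℝ) :
    Real.cos (pendulumSwing ω ξ t₀ t) =
      2 * deltaAmplitude ξ (jacobiAm ξ (ω * t + t₀)) ^ 2 - 1 := by
  rw [← cos_half_pendulumSwing, ← Real.cos_two_mul, mul_div_cancel₀ _ two_ne_zero]

theorem sin_pendulumSwing (hξ : ξ ∈ Ioo (0 : ℝ) 1) (ω t₀ t : ℝ) :
    Real.sin (pendulumSwing ω ξ t₀ t) = 2 * (ξ * Real.sin (jacobiAm ξ (ω * t + t₀))) *
      deltaAmplitude ξ (jacobiAm ξ (ω * t + t₀)) := by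
  rw [← cos_half_pendulumSwing ω, ← sin_half_pendulumSwing hξ, ← Real.sin_two_mul,
    mul_div_cancel₀ _ two_ne_zero]

theorem hasDerivAt_jacobiAm_linear (hξ : ξ ∈ Ioo (0 : ℝ) 1) (ω t₀ t : ℝ) :
    HasDerivAt (fun t => jacobiAm ξ (ω * t + t₀))
      (ω * deltaAmplitude ξ (jacobiAm ξ (ω * t + t₀))) t := by
  have := (hasDerivAt_jacobiAm hξ (ω * t + t₀)).comp t
    (((hasDerivAt_id t).const_mul ω).add_const t₀)
  convert! this using 1
  simp [mul_comm]

theorem hasDerivAt_pendulumSwing (hξ : ξ ∈ Ioo (0 : ℝ) 1) (ω t₀ t : ℝ) :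
    HasDerivAt (pendulumSwing ω ξ t₀)
      (2 * ξ * ω * Real.cos (jacobiAm ξ (ω * t + t₀))) t := by
  have hΔ := deltaAmplitude_pos hξ (jacobiAm ξ (ω * t + t₀))
  have h0 := one_sub_sq_mul_sin_sq_pos hξ (jacobiAm ξ (ω * t + t₀))
  have h1 : ξ * Real.sin (jacobiAm ξ (ω * t + t₀)) ≠ -1 := fun h => by
    rw [← mul_pow, h] at h0; norm_num at h0
  have h2 : ξ * Real.sin (jacobiAm ξ (ω * t + t₀)) ≠ 1 := fun h => by
    rw [← mul_pow, h] at h0; norm_num at h0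
  have := ((Real.hasDerivAt_arcsin h1 h2).comp t
    (((hasDerivAt_jacobiAm_linear hξ ω t₀ t).sin).const_mul ξ)).const_mul 2
  convert! this using 1
  rw [mul_pow, ← deltaAmplitude]
  field_simp

theorem isPendulum_pendulumSwing (hξ : ξ ∈ Ioo (0 : ℝ) 1) (ω t₀ : ℝ) :
    IsPendulum ω (pendulumSwing ω ξ t₀) := by
  refine .of_hasDerivAt (hasDerivAt_pendulumSwing hξ ω t₀) fun t => ?_
  convert! ((hasDerivAt_jacobiAm_linear hξ ω t₀ t).cos).const_mul (2 * ξ * ω) using 1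
  rw [sin_pendulumSwing hξ]; ring

/-- Motions with energy strictly between those of the two equilibria are swings. -/
theorem IsPendulum.exists_eq_pendulumSwing (hω : 0 < ω) (h : IsPendulum ω α)
    (h1 : -ω ^ 2 < energy ω α 0) (h2 : energy ω α 0 < ω ^ 2) :
    ∃ ξ ∈ Ioo (0 : ℝ) 1, ∃ (t₀ : ℝ) (k : ℤ),
      ∀ t, α t = pendulumSwing ω ξ t₀ t + k * (2 * Real.pi) := by
  have hp := Real.pi_pos
  set E := energy ω α 0 with hE
  -- The representative of the initial angle with `|a / 2| ≤ π/2`, where `arcsin` inverts `sin`.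
  set k : ℤ := round (α 0 / (2 * Real.pi))
  set a := α 0 - k * (2 * Real.pi) with ha
  have hk : |a / 2| ≤ Real.pi / 2 := by
    have := abs_sub_round (α 0 / (2 * Real.pi))
    have e : a / 2 = (α 0 / (2 * Real.pi) - k) * Real.pi := by rw [ha]; field_simp
    rw [e, abs_mul, abs_of_pos hp]
    nlinarith
  have hcos : Real.cos (α 0) = 1 - 2 * Real.sin (a / 2) ^ 2 := by
    have e : Real.cos a = Real.cos (α 0) := Real.cos_sub_int_mul_two_pi _ _
    have e2 := Real.cos_two_mul (a / 2)
    rw [mul_div_cancel₀ _ two_ne_zero, e] at e2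
    have := Real.sin_sq_add_cos_sq (a / 2)
    linarith
  have hr : 0 < (E + ω ^ 2) / (2 * ω ^ 2) := div_pos (by linarith) (by positivity)
  -- Solves `E = ω² (2ξ² - 1)`: `ξ` is the sine of half the maximal deflection.
  set ξ := Real.sqrt ((E + ω ^ 2) / (2 * ω ^ 2)) with hξdef
  have hξ2 : ξ ^ 2 = (E + ω ^ 2) / (2 * ω ^ 2) := Real.sq_sqrt hr.le
  have hξ0 : 0 < ξ := Real.sqrt_pos.2 hr
  have hξ : ξ ∈ Ioo (0 : ℝ) 1 := by
    refine ⟨hξ0, ?_⟩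
    have : ξ ^ 2 < 1 := by rw [hξ2, div_lt_one (by positivity)]; linarith
    nlinarith
  have hunit : (deriv α 0 / (2 * ξ * ω)) ^ 2 + (Real.sin (a / 2) / ξ) ^ 2 = 1 := by
    have e : deriv α 0 ^ 2 = 4 * ω ^ 2 * (ξ ^ 2 - Real.sin (a / 2) ^ 2) := by
      have : E = deriv α 0 ^ 2 / 2 - ω ^ 2 * Real.cos (α 0) := rfl
      rw [hcos] at this
      rw [hξ2]; field_simp; linarith
    rw [div_pow, e]; field_simp; ring
  -- A swing satisfies `α' = 2ξω cos φ` and `sin (α/2) = ξ sin φ`, so the argument of this unit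
  -- vector is the initial amplitude `φ`.
  set z : ℂ := ⟨deriv α 0 / (2 * ξ * ω), Real.sin (a / 2) / ξ⟩ with hz
  have hzn : ‖z‖ = 1 := by
    rw [Complex.norm_eq_sqrt_sq_add_sq, hz, hunit, Real.sqrt_one]
  have hz0 : z ≠ 0 := fun h => by rw [h] at hzn; simp at hzn
  have hc : Real.cos z.arg = deriv α 0 / (2 * ξ * ω) := by
    rw [Complex.cos_arg hz0, hzn, div_one]
  have hs : Real.sin z.arg = Real.sin (a / 2) / ξ := by
    rw [Complex.sin_arg, hzn, div_one]
  refine ⟨ξ, hξ, ellipticF ξ z.arg, k, fun t => ?_⟩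
  have hP : IsPendulum ω fun t => α t - k * (2 * Real.pi) :=
    .of_hasDerivAt (fun t => (h.hasDerivAt t).sub_const _)
      fun t => by rw [Real.sin_sub_int_mul_two_pi]; exact h.hasDerivAt_deriv t
  have := hP.unique (isPendulum_pendulumSwing hξ ω (ellipticF ξ z.arg)) ?_ ?_
  · linarith [congrFun this t]
  · simp only [pendulumSwing, mul_zero, zero_add, jacobiAm_ellipticF hξ, hs]
    rw [mul_div_cancel₀ _ hξ0.ne', Real.arcsin_sin (neg_le_of_abs_le hk) (le_of_abs_le hk)]
    ring
  · rw [(hasDerivAt_pendulumSwing hξ ω _ 0).deriv, deriv_sub_const]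
    simp only [mul_zero, zero_add, jacobiAm_ellipticF hξ, hc]
    field_simp

/-- Adding `2πk` to `α` multiplies `sin (α/2)` by `(-1)^k`. For odd `k` the sign is absorbed by
advancing the amplitude by `π`, which delays the phase by the complete integral. -/
theorem IsPendulum.isEllipticSwing (hξ : ξ ∈ Ioo (0 : ℝ) 1) {t₀ : ℝ} {k : ℤ}
    (hα : ∀ t, α t = pendulumSwing ω ξ t₀ t + k * (2 * Real.pi)) : IsEllipticSwing ω α := by
  have hhalf : ∀ t, α t / 2 = pendulumSwing ω ξ t₀ t / 2 + k * Real.pi := fun t => by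
    rw [hα]; ring
  rcases Int.even_or_odd k with hk | hk
  · refine ⟨ξ, hξ, t₀, fun t => ⟨_, ⟨jacobiAm ξ (ω * t + t₀), ellipticF_jacobiAm hξ _, rfl⟩, ?_⟩⟩
    rw [hhalf, Real.sin_add_int_mul_pi, hk.neg_one_zpow, one_mul, sin_half_pendulumSwing hξ]
  · refine ⟨ξ, hξ, t₀ + ellipticF ξ Real.pi, fun t =>
      ⟨_, ⟨jacobiAm ξ (ω * t + t₀) + Real.pi, ?_, rfl⟩, ?_⟩⟩
    · rw [ellipticF_add_pi hξ, ellipticF_jacobiAm hξ, add_assoc]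
    · rw [hhalf, Real.sin_add_int_mul_pi, hk.neg_one_zpow, Real.sin_add_pi,
        sin_half_pendulumSwing hξ]
      ring

/-- Over a closed curve the pendulum swings. -/
theorem IsPendulum.exists_swing_of_closesUp (hω : 0 < ω) (h : IsPendulum ω α) (hc : ClosesUp α) :
    ∃ ξ ∈ Ioo (0 : ℝ) 1, ∃ (t₀ : ℝ) (k : ℤ),
      ∀ t, α t = pendulumSwing ω ξ t₀ t + k * (2 * Real.pi) := by
  refine h.exists_eq_pendulumSwing hω ?_ (not_le.1 fun hE => h.not_closesUp hω hE hc)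
  -- Energy at most `-ω²` means rest at the lowest point, an equilibrium.
  by_contra hE
  have hω2 := pow_pos hω 2
  have hcos := Real.cos_le_one (α 0)
  simp only [energy, not_lt] at hE
  have h1 : deriv α 0 = 0 := by
    have : deriv α 0 ^ 2 ≤ 0 := by nlinarith
    exact pow_eq_zero_iff two_ne_zero |>.1 (le_antisymm this (sq_nonneg _))
  have h2 : Real.cos (α 0) = 1 := by
    rw [h1] at hE; nlinarith
  have h3 := Real.sin_sq_add_cos_sq (α 0)
  rw [h2] at h3
  exact (h.isEquilibrium h1 (by nlinarith)).not_closesUp hc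

end Pendulum

/-! ### Curves with tangent `u * exp (iα)` -/

section Tangent

variable {α : ℝ → ℝ} {γ : ℝ → ℂ} {u : ℂ}

theorem cos_add_sin_mul_I_eq_exp (x : ℝ) :
    ((Real.cos x : ℂ) + Real.sin x * Complex.I) = Complex.exp (x * Complex.I) := by
  rw [Complex.exp_mul_I, Complex.ofReal_cos, Complex.ofReal_sin]

theorem hasDerivAt_exp_mul_I {α' t : ℝ} (h : HasDerivAt α α' t) :
    HasDerivAt (fun t => Complex.exp (α t * Complex.I))
      (Complex.I * α' * Complex.exp (α t * Complex.I)) t := by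
  convert! (h.ofReal_comp.mul_const Complex.I).cexp using 1
  ring

theorem hasDerivAt_curveOf (hα : Continuous α) (t : ℝ) :
    HasDerivAt (curveOf α) (Complex.exp (α t * Complex.I)) t := by
  rw [← cos_add_sin_mul_I_eq_exp]
  exact (Continuous.integral_hasStrictDerivAt
    (f := fun s => (Real.cos (α s) : ℂ) + Real.sin (α s) * Complex.I)
    (by fun_prop) 0 t).hasDerivAt

theorem hasDerivAt_tangent (hα : ContDiff ℝ 1 α) (u : ℂ) (t : ℝ) :
    HasDerivAt (fun t => u * Complex.exp (α t * Complex.I))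
      (u * (Complex.I * deriv α t * Complex.exp (α t * Complex.I))) t :=
  (hasDerivAt_exp_mul_I (hα.differentiable (by norm_num) t).hasDerivAt).const_mul u

theorem contDiff_two_of_tangent (hα : ContDiff ℝ 1 α)
    (hγ : ∀ t, HasDerivAt γ (u * Complex.exp (α t * Complex.I)) t) : ContDiff ℝ 2 γ := by
  refine (contDiff_succ_iff_deriv (n := 1)).2 ⟨fun t => (hγ t).differentiableAt, by simp, ?_⟩
  rw [show deriv γ = fun t => u * Complex.exp (α t * Complex.I) from funext fun t => (hγ t).deriv]
  exact contDiff_const.mul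
    (((Complex.ofRealCLM.contDiff.comp hα).mul contDiff_const).cexp)

/-- The unit factor `u` is a fixed rotation; it allows the shape of a critical curve to be found
without rotating the curve itself. -/
theorem isClosedCurve_of_tangent {T : ℝ} (hT : 0 < T) (hu : ‖u‖ = 1) (hα : ContDiff ℝ 1 α)
    (hγ : ∀ t, HasDerivAt γ (u * Complex.exp (α t * Complex.I)) t)
    (hper : Function.Periodic γ T) : IsClosedCurve γ T :=
  ⟨hT, contDiff_two_of_tangent hα hγ, hper, fun t => by
    rw [(hγ t).deriv, norm_mul, hu, Complex.norm_exp_ofReal_mul_I, one_mul]⟩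

theorem conj_mul_self_of_norm_eq_one {z : ℂ} (hz : ‖z‖ = 1) : conj z * z = 1 := by
  rw [mul_comm, Complex.mul_conj, Complex.normSq_eq_norm_sq, hz]; simp

theorem curvature_of_tangent (hu : ‖u‖ = 1) (hα : ContDiff ℝ 1 α)
    (hγ : ∀ t, HasDerivAt γ (u * Complex.exp (α t * Complex.I)) t) (t : ℝ) :
    curvature γ t = deriv α t := by
  have h1 : deriv γ = fun t => u * Complex.exp (α t * Complex.I) := funext fun t => (hγ t).deriv
  have hn : ‖u * Complex.exp (α t * Complex.I)‖ = 1 := by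
    rw [norm_mul, hu, Complex.norm_exp_ofReal_mul_I, one_mul]
  rw [curvature, h1, (hasDerivAt_tangent hα u t).deriv, hn,
    show conj (u * Complex.exp (α t * Complex.I)) *
      (u * (Complex.I * deriv α t * Complex.exp (α t * Complex.I))) =
      conj (u * Complex.exp (α t * Complex.I)) * (u * Complex.exp (α t * Complex.I)) *
        (deriv α t * Complex.I) by ring, conj_mul_self_of_norm_eq_one hn]
  simp

/-- Two curves with equal velocities differ by a translation. -/
theorem eq_const_add_of_hasDerivAt {γ δ : ℝ → ℂ} {v : ℝ → ℂ} (hγ : ∀ t, HasDerivAt γ (v t) t)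
    (hδ : ∀ t, HasDerivAt δ (v t) t) (t : ℝ) : γ t = (γ 0 - δ 0) + δ t := by
  have hd : ∀ s, HasDerivAt (fun s => γ s - δ s) 0 s := fun s => by
    have := (hγ s).sub (hδ s)
    rwa [sub_self] at this
  have : γ t - δ t = γ 0 - δ 0 :=
    is_const_of_deriv_eq_zero (fun s => (hd s).differentiableAt) (fun s => (hd s).deriv) t 0
  rw [← this]; ring

theorem curveOf_two_pi_eq_zero (hα : Continuous α) (hc : ClosesUp α) :
    curveOf α (2 * Real.pi) = 0 := by
  rw [curveOf, intervalIntegral.integral_add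
    ((by fun_prop : Continuous fun s => (Real.cos (α s) : ℂ)).intervalIntegrable _ _)
    ((by fun_prop : Continuous fun s =>
      (Real.sin (α s) : ℂ) * Complex.I).intervalIntegrable _ _),
    intervalIntegral.integral_mul_const, intervalIntegral.integral_ofReal,
    intervalIntegral.integral_ofReal, hc.1, hc.2.1]
  simp

theorem apply_two_pi_eq_of_closesUp (hα : Continuous α) (hc : ClosesUp α)
    (hγ : ∀ t, HasDerivAt γ (u * Complex.exp (α t * Complex.I)) t) :
    γ (2 * Real.pi) = γ 0 := by
  have := eq_const_add_of_hasDerivAt hγ (fun t => (hasDerivAt_curveOf hα t).const_mul u)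
    (2 * Real.pi)
  rw [curveOf_two_pi_eq_zero hα hc] at this
  rw [this]; simp [curveOf]

end Tangent

/-! ### The case `ω = 0`: circles -/

section Circle

variable {γ : ℝ → ℂ} {u : ℂ} {a : ℝ} {k : ℤ}

/-- Equality of the exponentials means `k (s - t) = 2πn`; the bound on `s - t` gives `|n| < 1`. -/
theorem exp_int_mul_eq_iff {s t : ℝ} (hk : k ≠ 0)
    (hst : |s - t| < 2 * Real.pi / k.natAbs) :
    Complex.exp ((a + k * s : ℝ) * Complex.I) = Complex.exp ((a + k * t : ℝ) * Complex.I) ↔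
      s = t := by
  refine ⟨fun h => ?_, fun h => by rw [h]⟩
  obtain ⟨n, hn⟩ := Complex.exp_eq_exp_iff_exists_int.1 h
  have h1 : (a + k * s : ℝ) = (a + k * t : ℝ) + n * (2 * Real.pi) := by
    have h2 : ((a + k * s : ℝ) : ℂ) * Complex.I =
        ((a + k * t + n * (2 * Real.pi) : ℝ) : ℂ) * Complex.I := by
      rw [hn]; push_cast; ring
    exact_mod_cast mul_right_cancel₀ Complex.I_ne_zero h2
  have hk' : (0 : ℝ) < k.natAbs := by exact_mod_cast Int.natAbs_pos.2 hk
  have h3 : |(n : ℝ)| < 1 := by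
    have : (k : ℝ) * (s - t) = n * (2 * Real.pi) := by linarith
    have h4 : |(k : ℝ)| * |s - t| = |(n : ℝ)| * (2 * Real.pi) := by
      rw [← abs_mul, this, abs_mul, abs_of_pos (by positivity : (0 : ℝ) < 2 * Real.pi)]
    rw [lt_div_iff₀ hk'] at hst
    have h5 : |(k : ℝ)| = k.natAbs := by rw [Nat.cast_natAbs]; simp
    rw [← h5] at hst
    nlinarith [Real.pi_pos]
  have hn0 : n = 0 := by
    rw [← Int.cast_abs] at h3
    exact Int.abs_lt_one_iff.1 (by exact_mod_cast h3)
  rw [hn0] at h1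
  have : (k : ℝ) ≠ 0 := by exact_mod_cast hk
  have h2 : (k : ℝ) * s = k * t := by simpa using h1
  exact mul_left_cancel₀ this h2

theorem passedSeveralTimes_isCircle (hu : ‖u‖ = 1) (hk : k ≠ 0)
    (hγ : ∀ t, HasDerivAt γ (u * Complex.exp ((a + k * t : ℝ) * Complex.I)) t) :
    PassedSeveralTimes IsCircle γ := by
  have hkC : (k : ℂ) ≠ 0 := by exact_mod_cast hk
  have hkR : (k : ℝ) ≠ 0 := by exact_mod_cast hk
  have hu0 : u ≠ 0 := fun h => by simp [h] at hu
  have hN : (0 : ℝ) < k.natAbs := by exact_mod_cast Int.natAbs_pos.2 hk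
  -- Integrating the tangent gives `p + w exp (i(a + kt))`, of radius `‖w‖ = 1/|k|`.
  set w : ℂ := u / (Complex.I * k) with hw
  have hw0 : w ≠ 0 := div_ne_zero hu0 (mul_ne_zero Complex.I_ne_zero hkC)
  have hlin : ∀ t : ℝ, HasDerivAt (fun t : ℝ => a + k * t) (k : ℝ) t := fun t => by
    simpa using ((hasDerivAt_id t).const_mul (k : ℝ)).const_add a
  have hderiv : deriv (fun t : ℝ => a + k * t) = fun _ => (k : ℝ) :=
    funext fun t => (hlin t).deriv
  have hδ : ∀ t : ℝ, HasDerivAt (fun t : ℝ => w * Complex.exp ((a + k * t : ℝ) * Complex.I))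
      (u * Complex.exp ((a + k * t : ℝ) * Complex.I)) t := fun t => by
    convert! (hasDerivAt_exp_mul_I (hlin t)).const_mul w using 1
    rw [hw]; push_cast; field_simp
  obtain ⟨p, hp⟩ : ∃ p, ∀ t, γ t = p + w * Complex.exp ((a + k * t : ℝ) * Complex.I) :=
    ⟨_, eq_const_add_of_hasDerivAt hγ hδ⟩
  have hnw : ‖w‖ = 1 / k.natAbs := by
    rw [hw, norm_div, hu, norm_mul, Complex.norm_I, one_mul, Complex.norm_intCast,
      Nat.cast_natAbs, Int.cast_abs]
  refine ⟨k.natAbs, Int.natAbs_pos.2 hk, ?_, ?_, p, 1 / k.natAbs, by positivity, ?_⟩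
  · refine isClosedCurve_of_tangent (α := fun t => a + k * t) (by positivity) hu (by fun_prop) hγ
      fun t => ?_
    rw [hp, hp]
    congr 2
    rw [Complex.exp_eq_exp_iff_exists_int]
    -- Over time `2π/|k|` the exponent changes by `2πi` times the sign of `k`.
    rcases Int.natAbs_eq k with h | h
    · refine ⟨1, ?_⟩
      have h' : (k : ℂ) = (k.natAbs : ℂ) := by
        conv_lhs => rw [h]
        simp
      push_cast
      rw [h']
      have : (k.natAbs : ℂ) ≠ 0 := by exact_mod_cast hN.ne'
      field_simp
      ring
    · refine ⟨-1, ?_⟩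
      have h' : (k : ℂ) = -(k.natAbs : ℂ) := by
        conv_lhs => rw [h]
        simp
      push_cast
      rw [h']
      have : (k.natAbs : ℂ) ≠ 0 := by exact_mod_cast hN.ne'
      field_simp
      ring
  · intro s hs t ht hst
    rw [hp, hp] at hst
    refine (exp_int_mul_eq_iff hk ?_).1 (mul_left_cancel₀ hw0 (add_left_cancel hst))
    rw [abs_lt]
    constructor <;> linarith [hs.1, hs.2, ht.1, ht.2]
  · ext z
    simp only [mem_range, mem_sphere_iff_norm]
    constructor
    · rintro ⟨t, rfl⟩
      rw [hp, add_sub_cancel_left, norm_mul, Complex.norm_exp_ofReal_mul_I, mul_one, hnw]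
    · intro hz
      have h1 : ‖(z - p) / w‖ = 1 := by
        rw [norm_div, hz, hnw, div_self (by positivity)]
      refine ⟨(((z - p) / w).arg - a) / k, ?_⟩
      rw [hp, mul_div_cancel₀ _ hkR, add_sub_cancel]
      have h2 := Complex.norm_mul_exp_arg_mul_I ((z - p) / w)
      rw [h1, Complex.ofReal_one, one_mul] at h2
      rw [h2, mul_div_cancel₀ _ hw0, add_sub_cancel]

/-- Without gravity the pendulum draws circles. -/
theorem IsPendulum.passedSeveralTimes_isCircle {α : ℝ → ℝ} (h : IsPendulum 0 α)
    (hc : ClosesUp α) (hu : ‖u‖ = 1)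
    (hγ : ∀ t, HasDerivAt γ (u * Complex.exp (α t * Complex.I)) t) :
    PassedSeveralTimes IsCircle γ := by
  have h1 : ∀ t, deriv α t = deriv α 0 := fun t =>
    is_const_of_deriv_eq_zero (fun s => (h.hasDerivAt_deriv s).differentiableAt)
      (fun s => by rw [(h.hasDerivAt_deriv s).deriv]; simp) t 0
  have h2 : ∀ t, α t = α 0 + deriv α 0 * t := fun t => by
    have hd : ∀ s, HasDerivAt (fun s => α s - deriv α 0 * s) 0 s := fun s => by
      have := (h.hasDerivAt s).sub ((hasDerivAt_id s).const_mul (deriv α 0))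
      convert! this using 1
      rw [h1 s]; simp
    have : α t - deriv α 0 * t = α 0 - deriv α 0 * 0 :=
      is_const_of_deriv_eq_zero (fun s => (hd s).differentiableAt) (fun s => (hd s).deriv) t 0
    linarith
  obtain ⟨k, hk⟩ := hc.2.2
  have h3 : deriv α 0 = k := by
    have := h2 (2 * Real.pi)
    rw [hk] at this
    have hp := Real.pi_pos
    have : 2 * Real.pi * (deriv α 0 - k) = 0 := by linarith
    rcases mul_eq_zero.1 this with h | h <;> linarith
  have hk0 : k ≠ 0 := fun h0 => by
    refine IsEquilibrium.not_closesUp (fun t => ?_) hc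
    rw [h2 t, h3, h0]; simp
  refine PlaneCurve.passedSeveralTimes_isCircle (a := α 0) hu hk0 fun t => ?_
  rw [← h3, ← h2]
  exact hγ t

end Circle

/-! ### The case `ω > 0`: `∞`-shaped curves -/

section Infinity

variable {ω ξ t₀ : ℝ} {γ : ℝ → ℂ} {u : ℂ}

/-- The elastic curve of modulus `ξ`, as a function of the amplitude. -/
def elasticCurve (ξ φ : ℝ) : ℂ := ⟨elasticAbscissa ξ φ, -(2 * ξ * Real.cos φ)⟩

/-- Since `φ' = ωΔ`, the coordinates divided by `ω` have derivatives `2Δ² - 1 = cos α` and `2ξ Δ sin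
φ = sin α`. -/
theorem hasDerivAt_elasticCurve (hω : 0 < ω) (hξ : ξ ∈ Ioo (0 : ℝ) 1) (t₀ t : ℝ) :
    HasDerivAt (fun t => elasticCurve ξ (jacobiAm ξ (ω * t + t₀)) / ω)
      (Complex.exp (pendulumSwing ω ξ t₀ t * Complex.I)) t := by
  have hφ := hasDerivAt_jacobiAm_linear hξ ω t₀ t
  have hX : HasDerivAt (fun t => elasticAbscissa ξ (jacobiAm ξ (ω * t + t₀))) _ t :=
    (hasDerivAt_elasticAbscissa hξ _).comp t hφ
  have hY := (hφ.cos.const_mul (2 * ξ)).neg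
  have hΔ := (deltaAmplitude_pos hξ (jacobiAm ξ (ω * t + t₀))).ne'
  have := (hX.ofReal_comp.add (hY.ofReal_comp.mul_const Complex.I)).div_const (ω : ℂ)
  convert! this using 1
  · funext s
    rw [elasticCurve, Complex.mk_eq_add_mul_I]
    rfl
  · rw [← cos_add_sin_mul_I_eq_exp, cos_pendulumSwing, sin_pendulumSwing hξ]
    have hω' : (ω : ℂ) ≠ 0 := by exact_mod_cast hω.ne'
    have hΔ' : (deltaAmplitude ξ (jacobiAm ξ (ω * t + t₀)) : ℂ) ≠ 0 := by exact_mod_cast hΔ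
    push_cast
    field_simp

/-- Together with `elasticCurve_neg` this supplies the two reflections of the `∞`. -/
theorem IsClosingModulus.elasticCurve_add_pi (hξ : IsClosingModulus ξ) (φ : ℝ) :
    elasticCurve ξ (φ + Real.pi) = conj (elasticCurve ξ φ) := by
  simp [elasticCurve, Complex.ext_iff, hξ.add_pi, Real.cos_add_pi]

theorem elasticCurve_neg (ξ φ : ℝ) : elasticCurve ξ (-φ) = -conj (elasticCurve ξ φ) := by
  simp [elasticCurve, Complex.ext_iff, elasticAbscissa_neg]

theorem IsClosingModulus.elasticCurve_add_two_pi (hξ : IsClosingModulus ξ) (φ : ℝ) :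
    elasticCurve ξ (φ + 2 * Real.pi) = elasticCurve ξ φ := by
  rw [two_mul, ← add_assoc, hξ.elasticCurve_add_pi, hξ.elasticCurve_add_pi, Complex.conj_conj]

theorem IsClosingModulus.elasticCurve_half_pi (hξ : IsClosingModulus ξ) :
    elasticCurve ξ (Real.pi / 2) = 0 := by
  simp [elasticCurve, Complex.ext_iff, hξ.half_pi]

theorem IsClosingModulus.elasticCurve_three_half_pi (hξ : IsClosingModulus ξ) :
    elasticCurve ξ (3 * Real.pi / 2) = 0 := by
  rw [show 3 * Real.pi / 2 = Real.pi / 2 + Real.pi by ring, hξ.elasticCurve_add_pi,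
    hξ.elasticCurve_half_pi, map_zero]

/-- The closed elastic curve has only one double point, passed at amplitudes `π / 2` and
`3π / 2`. -/
theorem IsClosingModulus.eq_of_elasticCurve_eq (hξ : IsClosingModulus ξ) {x y : ℝ}
    (hx : x ∈ Ico (Real.pi / 2) (5 * Real.pi / 2)) (hy : y ∈ Ico (Real.pi / 2) (5 * Real.pi / 2))
    (h : elasticCurve ξ x = elasticCurve ξ y) :
    x = y ∨ (x = Real.pi / 2 ∧ y = 3 * Real.pi / 2) ∨
      (x = 3 * Real.pi / 2 ∧ y = Real.pi / 2) := by
  have hp := Real.pi_pos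
  have hX : elasticAbscissa ξ x = elasticAbscissa ξ y := congrArg Complex.re h
  have hcos : Real.cos x = Real.cos y := by
    have h1 : -(2 * ξ * Real.cos x) = -(2 * ξ * Real.cos y) := congrArg Complex.im h
    have h2 : 2 * ξ ≠ 0 := mul_ne_zero two_ne_zero hξ.1.1.ne'
    exact mul_left_cancel₀ h2 (neg_injective h1)
  have hper : Function.Periodic (elasticAbscissa ξ) Real.pi := hξ.add_pi
  have hmult : ∀ k : ℤ, y = x + 2 * k * Real.pi → x = y := fun k hk => by
    have h1 : (k : ℝ) < 1 := by nlinarith [hx.1, hx.2, hy.1, hy.2]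
    have h2 : (-1 : ℝ) < k := by nlinarith [hx.1, hx.2, hy.1, hy.2]
    have : k = 0 := by
      have h1' : k < 1 := by exact_mod_cast h1
      have h2' : -1 < k := by exact_mod_cast h2
      omega
    rw [hk, this]; simp
  have hzero : ∀ z ∈ Ico (Real.pi / 2) (5 * Real.pi / 2), Real.cos z = 0 →
      z = Real.pi / 2 ∨ z = 3 * Real.pi / 2 := by
    intro z hz hz0
    obtain ⟨k, hk⟩ := Real.cos_eq_zero_iff.1 hz0
    have h1 : (k : ℝ) < 2 := by nlinarith [hz.1, hz.2]
    have h2 : (-1 : ℝ) < k := by nlinarith [hz.1, hz.2]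
    have h1' : k < 2 := by exact_mod_cast h1
    have h2' : -1 < k := by exact_mod_cast h2
    obtain rfl | rfl : k = 0 ∨ k = 1 := by omega
    · left; rw [hk]; simp
    · right; rw [hk]; push_cast; ring
  obtain ⟨k, hk | hk⟩ := Real.cos_eq_cos_iff.1 hcos
  · exact Or.inl (hmult k (by rw [hk]; ring))
  -- Here `y = -x` modulo `2π`, so oddness and periodicity turn equal abscissas into a zero of the
  -- abscissa.
  · have hX0 : elasticAbscissa ξ x = 0 := by
      have h1 : elasticAbscissa ξ y = elasticAbscissa ξ (-x) := by
        rw [hk, show 2 * (k : ℝ) * Real.pi - x = -x + (2 * k : ℤ) * Real.pi by push_cast; ring]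
        exact hper.int_mul (2 * k) (-x)
      rw [elasticAbscissa_neg] at h1
      linarith
    -- If `sin x = 0`, then `-x` and `x` agree modulo `2π`, whence `x = y`; if `cos x = 0`, both
    -- amplitudes are among `π/2` and `3π/2`.
    rcases hξ.sin_eq_zero_or_cos_eq_zero hX0 with h0 | h0
    · obtain ⟨j, hj⟩ := Real.sin_eq_zero_iff.1 h0
      exact Or.inl (hmult (k - j) (by rw [hk, ← hj]; push_cast; ring))
    · rcases hzero x hx h0 with h1 | h1 <;> rcases hzero y hy (hcos ▸ h0) with h2 | h2 <;>
        simp [h1, h2]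

/-- An elastic curve with closing modulus is `∞`-shaped over one full swing of the pendulum. -/
theorem isInfinityShaped_of_swing (hω : 0 < ω) (hξ : IsClosingModulus ξ) (hu : ‖u‖ = 1)
    (hγ : ∀ t, HasDerivAt γ (u * Complex.exp (pendulumSwing ω ξ t₀ t * Complex.I)) t)
    {T : ℝ} (hT : ω * T = 2 * ellipticF ξ Real.pi) : IsInfinityShaped γ T := by
  have hp := Real.pi_pos
  have hω' : (ω : ℂ) ≠ 0 := by exact_mod_cast hω.ne'
  have hu0 : u ≠ 0 := fun h => by simp [h] at hu
  have hm := hξ.1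
  obtain ⟨p, hγp⟩ : ∃ p, ∀ t, γ t =
      p + u * (elasticCurve ξ (jacobiAm ξ (ω * t + t₀)) / ω) :=
    ⟨_, eq_const_add_of_hasDerivAt hγ
      fun t => (hasDerivAt_elasticCurve hω hm t₀ t).const_mul u⟩
  have hpend := isPendulum_pendulumSwing hm ω t₀
  set φ : ℝ → ℝ := fun t => jacobiAm ξ (ω * t + t₀) with hφ
  have hγφ : ∀ t, γ t = p + u * (elasticCurve ξ (φ t) / ω) := hγp
  -- The time at which the amplitude is `ψ`.
  set τ : ℝ → ℝ := fun ψ => (ellipticF ξ ψ - t₀) / ω with hτ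
  have hφτ : ∀ ψ, φ (τ ψ) = ψ := fun ψ => by
    simp only [hφ, hτ]
    rw [mul_div_cancel₀ _ hω.ne', sub_add_cancel, jacobiAm_ellipticF hm]
  have hmono : StrictMono φ := fun s t hst =>
    strictMono_jacobiAm hm (by nlinarith)
  have hφT : ∀ t, φ (t + T) = φ t + 2 * Real.pi := fun t => by
    simp only [hφ]
    rw [← jacobiAm_ellipticF hm (jacobiAm ξ (ω * t + t₀) + 2 * Real.pi), two_mul,
      ← add_assoc, ellipticF_add_pi hm, ellipticF_add_pi hm, ellipticF_jacobiAm hm]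
    congr 1
    linarith
  have hT0 : 0 < T := by
    have : 0 < ellipticF ξ Real.pi := by
      rw [← ellipticF_zero ξ]; exact strictMono_ellipticF hm hp
    by_contra h
    nlinarith
  have hclosed : IsClosedCurve γ T := by
    refine isClosedCurve_of_tangent hT0 hu (hpend.1.of_le (by norm_num)) hγ fun t => ?_
    rw [hγφ, hγφ, hφT, hξ.elasticCurve_add_two_pi]
  -- The period is cut at the double point, so that the two lobes are the arcs where `cos φ` has a
  -- constant sign.
  set a := τ (Real.pi / 2) with ha
  set b := τ (3 * Real.pi / 2) with hb
  have hφa : φ a = Real.pi / 2 := hφτ _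
  have hφb : φ b = 3 * Real.pi / 2 := hφτ _
  have hφaT : φ (a + T) = 5 * Real.pi / 2 := by rw [hφT, hφa]; ring
  have hγa : γ a = p := by rw [hγφ, hφa, hξ.elasticCurve_half_pi]; simp
  have hγb : γ b = p := by rw [hγφ, hφb, hξ.elasticCurve_three_half_pi]; simp
  have hsub : ∀ t, γ t - γ a = u * (elasticCurve ξ (φ t) / ω) := fun t => by
    rw [hγa, hγφ]; ring
  have hrange : ∀ s ∈ Ico a (a + T), φ s ∈ Ico (Real.pi / 2) (5 * Real.pi / 2) := fun s hs =>
    ⟨hφa ▸ hmono.monotone hs.1, hφaT ▸ hmono hs.2⟩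
  -- The coordinate along `n = u i` and the curvature are multiples of `cos φ` with opposite signs;
  -- this settles both the separation of the lobes and their bending.
  have hnormal : ∀ t, (conj (u * Complex.I) * (γ t - γ a)).re = -(2 * ξ / ω * Real.cos (φ t)) := by
    intro t
    rw [hsub, map_mul, Complex.conj_I,
      show conj u * -Complex.I * (u * (elasticCurve ξ (φ t) / ω)) =
        (conj u * u) * (-Complex.I * (elasticCurve ξ (φ t) / ω)) by ring,
      conj_mul_self_of_norm_eq_one hu, elasticCurve]
    simp
    ring
  have hcurv : ∀ t, curvature γ t = 2 * ξ * ω * Real.cos (φ t) := fun t => by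
    rw [curvature_of_tangent hu (hpend.1.of_le (by norm_num)) hγ,
      (hasDerivAt_pendulumSwing hm ω t₀ t).deriv]
  have hcos1 : ∀ t ∈ Ioo a b, Real.cos (φ t) < 0 := fun t ht => by
    have h1 := hmono ht.1
    have h2 := hmono ht.2
    rw [hφa] at h1
    rw [hφb] at h2
    exact Real.cos_neg_of_pi_div_two_lt_of_lt h1 (by linarith)
  have hcos2 : ∀ t ∈ Ioo b (a + T), 0 < Real.cos (φ t) := fun t ht => by
    have h1 := hmono ht.1
    have h2 := hmono ht.2
    rw [hφb] at h1
    rw [hφaT] at h2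
    rw [← Real.cos_sub_two_pi]
    exact Real.cos_pos_of_mem_Ioo ⟨by linarith, by linarith⟩
  have hξω : 0 < 2 * ξ / ω := div_pos (by linarith [hm.1]) hω
  have hξω' : 0 < 2 * ξ * ω := mul_pos (by linarith [hm.1]) hω
  refine ⟨hclosed, a, b, u * Complex.I, ?_, ?_, by simp [hu], by rw [hγa, hγb], ?_, ?_, ?_, ?_,
    Or.inr ⟨?_, ?_⟩, ?_, ?_⟩
  · rw [← hmono.lt_iff_lt, hφa, hφb]; linarith
  · rw [← hmono.lt_iff_lt, hφaT, hφb]; linarith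
  · intro s hs t ht hst
    rw [hγφ, hγφ] at hst
    have h1 : elasticCurve ξ (φ s) = elasticCurve ξ (φ t) :=
      (div_left_inj' hω').1 (mul_left_cancel₀ hu0 (add_left_cancel hst))
    have h2 : ∀ x y, x = y ↔ φ x = φ y := fun x y => hmono.injective.eq_iff.symm
    rw [h2 s t, h2 s a, h2 t b, h2 s b, h2 t a, hφa, hφb]
    exact hξ.eq_of_elasticCurve_eq (hrange s hs) (hrange t ht) h1
  -- Up to the rotation `u`, the two tangents are `(2Δ² - 1, ±2ξΔ)` with both entries nonzero.
  · rw [(hγ a).deriv, (hγ b).deriv, LinearIndependent.pair_iff]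
    intro x y hxy
    have hΔ := deltaAmplitude_pos hm (Real.pi / 2)
    have hΔ2 := deltaAmplitude_sq hm (Real.pi / 2)
    have hΔb : deltaAmplitude ξ (3 * Real.pi / 2) = deltaAmplitude ξ (Real.pi / 2) := by
      rw [show 3 * Real.pi / 2 = Real.pi / 2 + Real.pi by ring, deltaAmplitude_add_pi]
    have hsb : Real.sin (3 * Real.pi / 2) = -1 := by
      rw [show 3 * Real.pi / 2 = Real.pi / 2 + Real.pi by ring, Real.sin_add_pi,
        Real.sin_pi_div_two]
    have h1 : x * Complex.exp (pendulumSwing ω ξ t₀ a * Complex.I) +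
        y * Complex.exp (pendulumSwing ω ξ t₀ b * Complex.I) = 0 := by
      refine mul_left_cancel₀ hu0 ?_
      rw [mul_zero, ← hxy]
      simp only [Complex.real_smul]
      ring
    have hφa' : jacobiAm ξ (ω * a + t₀) = Real.pi / 2 := hφa
    have hφb' : jacobiAm ξ (ω * b + t₀) = 3 * Real.pi / 2 := hφb
    rw [← cos_add_sin_mul_I_eq_exp, ← cos_add_sin_mul_I_eq_exp, cos_pendulumSwing,
      cos_pendulumSwing, sin_pendulumSwing hm, sin_pendulumSwing hm, hφa', hφb', hΔb, hsb,
      Real.sin_pi_div_two] at h1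
    rw [Real.sin_pi_div_two, one_pow, mul_one] at hΔ2
    have hre := congrArg Complex.re h1
    have him := congrArg Complex.im h1
    simp only [Complex.add_re, Complex.mul_re, Complex.ofReal_re,
      Complex.ofReal_im, Complex.I_re, Complex.I_im, Complex.add_im, Complex.mul_im,
      Complex.zero_re, Complex.zero_im] at hre him
    have hne : 2 * deltaAmplitude ξ (Real.pi / 2) ^ 2 - 1 ≠ 0 := by
      have := hξ.two_mul_one_sub_sq_lt_one
      rw [hΔ2]; linarith
    have e1 : (x + y) * (2 * deltaAmplitude ξ (Real.pi / 2) ^ 2 - 1) = 0 := by linarith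
    have e2 : (x - y) * (2 * ξ * deltaAmplitude ξ (Real.pi / 2)) = 0 := by linarith
    have hne2 : 2 * ξ * deltaAmplitude ξ (Real.pi / 2) ≠ 0 :=
      (mul_pos (by linarith [hm.1]) hΔ).ne'
    have e1' := (mul_eq_zero.1 e1).resolve_right hne
    have e2' := (mul_eq_zero.1 e2).resolve_right hne2
    constructor <;> linarith
  · intro t ht
    rw [hnormal]
    nlinarith [hcos1 t ht]
  · intro t ht
    rw [hnormal]
    nlinarith [hcos2 t ht]
  · intro t ht
    rw [hcurv]
    nlinarith [hcos1 t ht]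
  · intro t ht
    rw [hcurv]
    nlinarith [hcos2 t ht]
  · intro t
    -- Reflection in the axis along `n` reverses the amplitude.
    refine ⟨τ (-φ t), ?_⟩
    rw [hsub, hγa, hγφ, hφτ, elasticCurve_neg, mul_pow, Complex.I_sq, map_mul, map_div₀,
      Complex.conj_ofReal]
    linear_combination (u * conj (elasticCurve ξ (φ t)) / ω) * conj_mul_self_of_norm_eq_one hu
  · intro t
    -- Reflection in the orthogonal axis advances the amplitude by half a swing.
    refine ⟨τ (φ t + Real.pi), ?_⟩
    rw [hsub, hγa, hγφ, hφτ, hξ.elasticCurve_add_pi, mul_pow, Complex.I_sq, map_mul, map_div₀,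
      Complex.conj_ofReal]
    linear_combination (-u * conj (elasticCurve ξ (φ t)) / ω) * conj_mul_self_of_norm_eq_one hu

/-- Equal endpoints and tangents determine `cos φ` and `sin φ`, so the amplitude advances by `2πn`
with `n ≥ 1`. The abscissa then grows by `2n X π = 0`, which makes the modulus closing, and one
swing lasts `2π/n`. -/
theorem passedSeveralTimes_isInfinityShaped (hω : 0 < ω) (hξ : ξ ∈ Ioo (0 : ℝ) 1)
    (hu : ‖u‖ = 1)
    (hγ : ∀ t, HasDerivAt γ (u * Complex.exp (pendulumSwing ω ξ t₀ t * Complex.I)) t)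
    (hclose : γ (2 * Real.pi) = γ 0)
    (hcos : Real.cos (pendulumSwing ω ξ t₀ (2 * Real.pi)) = Real.cos (pendulumSwing ω ξ t₀ 0))
    (hsin : Real.sin (pendulumSwing ω ξ t₀ (2 * Real.pi)) = Real.sin (pendulumSwing ω ξ t₀ 0)) :
    PassedSeveralTimes IsInfinityShaped γ := by
  have hp := Real.pi_pos
  have hω' : (ω : ℂ) ≠ 0 := by exact_mod_cast hω.ne'
  have hu0 : u ≠ 0 := fun h => by simp [h] at hu
  have hγp := eq_const_add_of_hasDerivAt hγ
    (fun t => (hasDerivAt_elasticCurve hω hξ t₀ t).const_mul u) (2 * Real.pi)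
  have hE : elasticCurve ξ (jacobiAm ξ (ω * (2 * Real.pi) + t₀)) =
      elasticCurve ξ (jacobiAm ξ (ω * 0 + t₀)) := by
    rw [hclose] at hγp
    refine (div_left_inj' hω').1 (mul_left_cancel₀ hu0 ?_)
    linear_combination -hγp
  rw [cos_pendulumSwing, cos_pendulumSwing] at hcos
  rw [sin_pendulumSwing hξ, sin_pendulumSwing hξ] at hsin
  set x := jacobiAm ξ (ω * 0 + t₀) with hx
  set y := jacobiAm ξ (ω * (2 * Real.pi) + t₀) with hy
  have hxy : x < y := strictMono_jacobiAm hξ (by nlinarith)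
  have hc : Real.cos y = Real.cos x := by
    have h1 : -(2 * ξ * Real.cos y) = -(2 * ξ * Real.cos x) := congrArg Complex.im hE
    exact mul_left_cancel₀ (mul_ne_zero two_ne_zero hξ.1.ne') (neg_injective h1)
  have hX : elasticAbscissa ξ y = elasticAbscissa ξ x := congrArg Complex.re hE
  have hΔx := deltaAmplitude_pos hξ x
  have hΔy := deltaAmplitude_pos hξ y
  have hΔ : deltaAmplitude ξ y = deltaAmplitude ξ x :=
    -- `cos α` determines `Δ²`, hence `Δ > 0`; dividing it out of `sin α` then recovers `sin φ`.
    (pow_left_inj₀ hΔy.le hΔx.le two_ne_zero).1 (by linarith)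
  have hs : Real.sin y = Real.sin x := by
    rw [hΔ] at hsin
    have h1 := mul_right_cancel₀ hΔx.ne' hsin
    exact mul_left_cancel₀ hξ.1.ne' (mul_left_cancel₀ two_ne_zero h1)
  obtain ⟨k, hk⟩ := Real.Angle.angle_eq_iff_two_pi_dvd_sub.1 (Real.Angle.cos_sin_inj hc hs)
  have hk0 : 0 < k := by
    have : (0 : ℝ) < k := by
      by_contra h
      nlinarith
    exact_mod_cast this
  obtain ⟨n, rfl⟩ := Int.eq_ofNat_of_zero_le hk0.le
  have hn : 1 ≤ n := by omega
  have hn' : (0 : ℝ) < n := by exact_mod_cast hn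
  have hyx : y = x + (2 * n : ℕ) * Real.pi := by
    push_cast at hk ⊢
    linarith
  have hmod : IsClosingModulus ξ := by
    refine ⟨hξ, ?_⟩
    rw [hyx, add_nat_mul_pi_eq (elasticAbscissa_add_pi hξ)] at hX
    have : ((2 * n : ℕ) : ℝ) * elasticAbscissa ξ Real.pi = 0 := by linarith
    refine (mul_eq_zero.1 this).resolve_left ?_
    push_cast
    positivity
  refine ⟨n, hn, isInfinityShaped_of_swing hω hmod hu hγ ?_⟩
  have hF := congrArg (ellipticF ξ) hyx
  rw [add_nat_mul_pi_eq (ellipticF_add_pi hξ), hx, hy, ellipticF_jacobiAm hξ,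
    ellipticF_jacobiAm hξ] at hF
  push_cast at hF
  field_simp
  linarith

/-- Closed curves drawn by a pendulum under gravity are `∞`-shaped. -/
theorem IsPendulum.passedSeveralTimes_isInfinityShaped {α : ℝ → ℝ} (hω : 0 < ω)
    (h : IsPendulum ω α) (hc : ClosesUp α) (hu : ‖u‖ = 1)
    (hγ : ∀ t, HasDerivAt γ (u * Complex.exp (α t * Complex.I)) t) :
    PassedSeveralTimes IsInfinityShaped γ ∧ IsEllipticSwing ω α := by
  obtain ⟨ξ, hξ, t₀, k, hα⟩ := h.exists_swing_of_closesUp hω hc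
  refine ⟨?_, IsPendulum.isEllipticSwing hξ hα⟩
  have hsin : ∀ t, Real.sin (pendulumSwing ω ξ t₀ t) = Real.sin (α t) := fun t => by
    rw [hα, Real.sin_add_int_mul_two_pi]
  have hcos : ∀ t, Real.cos (pendulumSwing ω ξ t₀ t) = Real.cos (α t) := fun t => by
    rw [hα, Real.cos_add_int_mul_two_pi]
  obtain ⟨j, hj⟩ := hc.2.2
  refine PlaneCurve.passedSeveralTimes_isInfinityShaped (t₀ := t₀) hω hξ hu (fun t => ?_)
    (apply_two_pi_eq_of_closesUp h.1.continuous hc hγ) ?_ ?_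
  · rw [← cos_add_sin_mul_I_eq_exp, hsin, hcos, cos_add_sin_mul_I_eq_exp]
    exact hγ t
  · rw [hcos, hcos, hj, mul_comm (2 * Real.pi) (j : ℝ), Real.cos_add_int_mul_two_pi]
  · rw [hsin, hsin, hj, mul_comm (2 * Real.pi) (j : ℝ), Real.sin_add_int_mul_two_pi]

/-- The shapes of the closed curves drawn by pendulums. -/
theorem IsPendulum.shape {α : ℝ → ℝ} (hω : 0 ≤ ω) (h : IsPendulum ω α) (hc : ClosesUp α)
    (hu : ‖u‖ = 1) (hγ : ∀ t, HasDerivAt γ (u * Complex.exp (α t * Complex.I)) t) :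
    (ω = 0 ∧ PassedSeveralTimes IsCircle γ) ∨
      (0 < ω ∧ PassedSeveralTimes IsInfinityShaped γ ∧ IsEllipticSwing ω α) := by
  rcases hω.eq_or_lt with rfl | hω
  · exact Or.inl ⟨rfl, h.passedSeveralTimes_isCircle hc hu hγ⟩
  · exact Or.inr ⟨hω, h.passedSeveralTimes_isInfinityShaped hω hc hu hγ⟩

end Infinity

/-! ### Families with jointly continuous derivative in the parameter -/

section ContinuousFamily

variable {V F : Type*} [NormedAddCommGroup V] [NormedSpace ℝ V] [NormedAddCommGroup F]
  [NormedSpace ℝ F]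

/-- `K` is the derivative of the family of functions `f v : ℝ → F` in the parameter `v : V`, and
both are jointly continuous. -/
structure IsDerivFamily (f : V → ℝ → F) (K : V → ℝ → V →L[ℝ] F) : Prop where
  continuous : Continuous (Function.uncurry f)
  continuous_deriv : Continuous (Function.uncurry K)
  hasFDerivAt : ∀ v t, HasFDerivAt (fun v => f v t) (K v t) v

variable {f : V → ℝ → F} {K : V → ℝ → V →L[ℝ] F}

theorem IsDerivFamily.hasFDerivAt_integral [ProperSpace V] [CompleteSpace F]
    (h : IsDerivFamily f K) (v : V) (b : ℝ) :
    HasFDerivAt (fun v => ∫ t in (0 : ℝ)..b, f v t) (∫ t in (0 : ℝ)..b, K v t) v := by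
  -- Compactness of ball times interval provides a constant dominating the derivative.
  obtain ⟨C, hC⟩ := ((isCompact_closedBall v 1).prod (isCompact_uIcc (a := (0 : ℝ))
    (b := b))).exists_bound_of_continuousOn h.continuous_deriv.continuousOn
  have hf : ∀ v, Continuous (f v) := fun v => h.continuous.comp (Continuous.prodMk_right v)
  have hK : ∀ v, Continuous (K v) := fun v => h.continuous_deriv.comp (Continuous.prodMk_right v)
  refine intervalIntegral.hasFDerivAt_integral_of_dominated_of_fderiv_le
    (bound := fun _ => C) (Metric.closedBall_mem_nhds v one_pos)
    (Filter.Eventually.of_forall fun v => (hf v).aestronglyMeasurable)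
    ((hf v).intervalIntegrable _ _) (hK v).aestronglyMeasurable
    (Filter.Eventually.of_forall fun t ht w hw => hC (w, t) ⟨hw, uIoc_subset_uIcc ht⟩)
    intervalIntegrable_const
    (Filter.Eventually.of_forall fun t _ w _ => h.hasFDerivAt w t)

/-- Stability under primitives, exponentials and products covers the curve, its tangent and its
acceleration, all built from an affine family of angles. -/
theorem IsDerivFamily.integral [ProperSpace V] [CompleteSpace F] (h : IsDerivFamily f K) :
    IsDerivFamily (fun v b => ∫ t in (0 : ℝ)..b, f v t) (fun v b => ∫ t in (0 : ℝ)..b, K v t) where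
  continuous := intervalIntegral.continuous_parametric_primitive_of_continuous h.continuous
  continuous_deriv :=
    intervalIntegral.continuous_parametric_primitive_of_continuous h.continuous_deriv
  hasFDerivAt := h.hasFDerivAt_integral

theorem IsDerivFamily.integral_apply [CompleteSpace F] (h : IsDerivFamily f K) (v x : V) (b : ℝ) :
    (∫ t in (0 : ℝ)..b, K v t) x = ∫ t in (0 : ℝ)..b, K v t x := by
  have hK : Continuous fun t => K v t := h.continuous_deriv.comp (Continuous.prodMk_right v)
  exact ContinuousLinearMap.intervalIntegral_apply (hK.intervalIntegrable _ _) x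

theorem IsDerivFamily.contDiff (h : IsDerivFamily f K) (t : ℝ) :
    ContDiff ℝ 1 fun v => f v t := by
  rw [contDiff_one_iff_fderiv]
  refine ⟨fun v => (h.hasFDerivAt v t).differentiableAt, ?_⟩
  rw [show fderiv ℝ (fun v => f v t) = fun v => K v t from
    funext fun v => (h.hasFDerivAt v t).fderiv]
  exact h.continuous_deriv.comp (Continuous.prodMk_left t)

theorem isDerivFamily_affine {a : ℝ → F} {L : ℝ → V →L[ℝ] F} (ha : Continuous a)
    (hL : Continuous L) : IsDerivFamily (fun v t => a t + L t v) fun _ t => L t where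
  continuous := by
    simp only [Function.uncurry_def]
    fun_prop
  continuous_deriv := hL.comp continuous_snd
  hasFDerivAt v t := (L t).hasFDerivAt.const_add (a t)

theorem IsDerivFamily.exp_mul_I {f : V → ℝ → ℝ} {K : V → ℝ → V →L[ℝ] ℝ}
    (h : IsDerivFamily f K) :
    IsDerivFamily (fun v t => Complex.exp (f v t * Complex.I))
      fun v t => (K v t).smulRight (Complex.I * Complex.exp (f v t * Complex.I)) where
  continuous := by
    have := h.continuous
    simp only [Function.uncurry_def] at this ⊢
    fun_prop
  continuous_deriv := by
    have h1 := h.continuous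
    have h2 := h.continuous_deriv
    simp only [Function.uncurry_def] at h1 h2 ⊢
    fun_prop
  hasFDerivAt v t := by
    have h1 : HasDerivAt (fun x : ℝ => Complex.exp (x * Complex.I))
        (Complex.I * Complex.exp (f v t * Complex.I)) (f v t) := by
      convert! hasDerivAt_exp_mul_I (hasDerivAt_id (f v t)) using 1
      simp
    convert! h1.hasFDerivAt.comp v (h.hasFDerivAt v t) using 1

theorem IsDerivFamily.mul {A : Type*} [NormedField A] [NormedAlgebra ℝ A]
    {f g : V → ℝ → A} {K M : V → ℝ → V →L[ℝ] A}
    (hf : IsDerivFamily f K) (hg : IsDerivFamily g M) :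
    IsDerivFamily (fun v t => f v t * g v t) fun v t => f v t • M v t + g v t • K v t where
  continuous := hf.continuous.mul hg.continuous
  continuous_deriv := (hf.continuous.smul hg.continuous_deriv).add
    (hg.continuous.smul hf.continuous_deriv)
  hasFDerivAt v t := (hf.hasFDerivAt v t).mul (hg.hasFDerivAt v t)

theorem IsDerivFamily.clm_comp {F' : Type*} [NormedAddCommGroup F'] [NormedSpace ℝ F']
    (h : IsDerivFamily f K) (T : F →L[ℝ] F') :
    IsDerivFamily (fun v t => T (f v t)) fun v t => T.comp (K v t) where
  continuous := T.continuous.comp h.continuous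
  continuous_deriv := continuous_const.clm_comp h.continuous_deriv
  hasFDerivAt v t := T.hasFDerivAt.comp v (h.hasFDerivAt v t)

/-- A family with jointly continuous derivatives stays so along a `C¹` path of parameters. -/
theorem IsDerivFamily.exists_deriv_along {p p' : ℝ → V} {s : Set ℝ} (h : IsDerivFamily f K)
    (hp : ∀ x ∈ s, HasDerivAt p (p' x) x) (hp' : ContinuousOn p' s) :
    ∃ D : ℝ → ℝ → F, ContinuousOn (Function.uncurry D) (s ×ˢ univ) ∧
      ∀ x ∈ s, ∀ t, HasDerivAt (fun x => f (p x) t) (D x t) x := by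
  refine ⟨fun x t => K (p x) t (p' x), ?_, fun x hx t =>
    (h.hasFDerivAt (p x) t).comp_hasDerivAt x (hp x hx)⟩
  have hp0 : ContinuousOn p s := fun x hx => (hp x hx).continuousAt.continuousWithinAt
  have h1 : ContinuousOn (fun q : ℝ × ℝ => p q.1) (s ×ˢ univ) :=
    hp0.comp continuousOn_fst fun q hq => hq.1
  have h2 : ContinuousOn (fun q : ℝ × ℝ => p' q.1) (s ×ˢ univ) :=
    hp'.comp continuousOn_fst fun q hq => hq.1
  exact (h.continuous_deriv.comp_continuousOn (h1.prodMk continuousOn_snd)).clm_apply h2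

end ContinuousFamily

/-! ### Orthogonal projection in `L²` over a period -/

section Projection

variable {M : Type*} [AddCommGroup M] [Module ℝ M]

/-- One step of the Gram-Schmidt process for a symmetric bilinear form. -/
theorem exists_orthogonal_sup_span {B : M →ₗ[ℝ] M →ₗ[ℝ] ℝ} (hB : ∀ x y, B x y = B y x)
    (hc : ∀ x e, ∃ c : ℝ, B (x - c • e) e = 0) {W : Submodule ℝ M}
    (hW : ∀ x, ∃ s ∈ W, ∀ w ∈ W, B (x - s) w = 0) (e : M) (x : M) :
    ∃ s ∈ W ⊔ ℝ ∙ e, ∀ w ∈ W ⊔ ℝ ∙ e, B (x - s) w = 0 := by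
  obtain ⟨p, hpW, hp⟩ := hW x
  obtain ⟨q, hqW, hq⟩ := hW e
  obtain ⟨c, hc⟩ := hc x (e - q)
  have he : e ∈ W ⊔ ℝ ∙ e := Submodule.mem_sup_right (Submodule.mem_span_singleton_self e)
  -- `e - q` is the component of `e` orthogonal to `W`; removing its multiple does not disturb
  -- orthogonality to `W`.
  refine ⟨p + c • (e - q), add_mem (Submodule.mem_sup_left hpW)
    (Submodule.smul_mem _ _ (sub_mem he (Submodule.mem_sup_left hqW))), ?_⟩
  have h1 : ∀ w ∈ W, B (x - (p + c • (e - q))) w = 0 := fun w hw => by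
    have h2 := hp w hw
    have h3 := hq w hw
    rw [← sub_sub, map_sub, LinearMap.sub_apply, h2, map_smul, LinearMap.smul_apply, h3]
    simp
  have h4 : B (x - (p + c • (e - q))) (e - q) = 0 := by
    have h5 := hq p hpW
    rw [hB] at h5
    rw [show x - (p + c • (e - q)) = (x - c • (e - q)) - p by abel,
      LinearMap.map_sub₂, hc, h5, sub_zero]
  intro w hw
  obtain ⟨w₁, hw₁, w₂, hw₂, rfl⟩ := Submodule.mem_sup.1 hw
  obtain ⟨d, rfl⟩ := Submodule.mem_span_singleton.1 hw₂
  rw [show w₁ + d • e = (w₁ + d • q) + d • (e - q) by module, map_add, map_smul, h4,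
    h1 _ (add_mem hw₁ (Submodule.smul_mem _ _ hqW))]
  simp

/-- The `L²` product over a period. -/
def periodInner : C(ℝ, ℝ) →ₗ[ℝ] C(ℝ, ℝ) →ₗ[ℝ] ℝ :=
  have hi : ∀ f g : C(ℝ, ℝ), IntervalIntegrable (fun t => f t * g t) MeasureTheory.volume
      0 (2 * Real.pi) := fun f g => (f.continuous.mul g.continuous).intervalIntegrable _ _
  LinearMap.mk₂ ℝ (fun f g => ∫ t in (0 : ℝ)..(2 * Real.pi), f t * g t)
    (fun f f' g => by
      simp only [ContinuousMap.add_apply, add_mul]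
      exact intervalIntegral.integral_add (hi f g) (hi f' g))
    (fun c f g => by
      simp only [ContinuousMap.smul_apply, smul_eq_mul, mul_assoc]
      exact intervalIntegral.integral_const_mul _ _)
    (fun f g g' => by
      simp only [ContinuousMap.add_apply, mul_add]
      exact intervalIntegral.integral_add (hi f g) (hi f g'))
    (fun c f g => by
      simp only [ContinuousMap.smul_apply, smul_eq_mul, mul_left_comm _ c]
      exact intervalIntegral.integral_const_mul _ _)

theorem periodInner_apply (f g : C(ℝ, ℝ)) :
    periodInner f g = ∫ t in (0 : ℝ)..(2 * Real.pi), f t * g t := rfl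

theorem eq_zero_of_integral_mul_self_eq_zero {f : ℝ → ℝ} (hf : Continuous f)
    (h : ∫ t in (0 : ℝ)..(2 * Real.pi), f t * f t = 0) : ∀ t ∈ Icc 0 (2 * Real.pi), f t = 0 := by
  intro t ht
  by_contra hne
  have : 0 < ∫ t in (0 : ℝ)..(2 * Real.pi), f t * f t :=
    intervalIntegral.integral_pos (by positivity) (hf.mul hf).continuousOn
      (fun x _ => mul_self_nonneg _) ⟨t, ht, mul_self_pos.2 hne⟩
  exact this.ne' h

/-- The form is only semidefinite: when `e` has zero norm it vanishes on the whole period, and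
everything is orthogonal to it. -/
theorem exists_sub_smul_orthogonal (f e : C(ℝ, ℝ)) :
    ∃ c : ℝ, periodInner (f - c • e) e = 0 := by
  by_cases h : periodInner e e = 0
  · refine ⟨0, ?_⟩
    have hz := eq_zero_of_integral_mul_self_eq_zero e.continuous h
    rw [periodInner_apply, intervalIntegral.integral_congr (g := fun _ => 0),
      intervalIntegral.integral_zero]
    intro t ht
    rw [uIcc_of_le (by positivity)] at ht
    simp [hz t ht]
  · exact ⟨periodInner f e / periodInner e e, by simp [h]⟩

/-- Orthogonal projection to the span of three functions. -/
theorem exists_orthogonal_three (f e₁ e₂ e₃ : C(ℝ, ℝ)) :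
    ∃ a b c : ℝ, periodInner (f - (a • e₁ + b • e₂ + c • e₃)) e₁ = 0 ∧
      periodInner (f - (a • e₁ + b • e₂ + c • e₃)) e₂ = 0 ∧
      periodInner (f - (a • e₁ + b • e₂ + c • e₃)) e₃ = 0 := by
  have hB : ∀ f g, periodInner f g = periodInner g f := fun f g => by
    simp only [periodInner_apply, mul_comm]
  have step := fun W hW => exists_orthogonal_sup_span (W := W) hB exists_sub_smul_orthogonal hW
  have h0 : ∀ x : C(ℝ, ℝ), ∃ s ∈ (⊥ : Submodule ℝ C(ℝ, ℝ)), ∀ w ∈ (⊥ : Submodule ℝ C(ℝ, ℝ)),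
      periodInner (x - s) w = 0 := fun x => ⟨0, zero_mem _, fun w hw => by
    rw [(Submodule.mem_bot ℝ).1 hw, map_zero]⟩
  obtain ⟨s, hs, h⟩ := step _ (step _ (step _ h0 e₁) e₂) e₃ f
  have m₁ : e₁ ∈ (⊥ ⊔ ℝ ∙ e₁) ⊔ ℝ ∙ e₂ ⊔ ℝ ∙ e₃ := Submodule.mem_sup_left
    (Submodule.mem_sup_left (Submodule.mem_sup_right (Submodule.mem_span_singleton_self _)))
  have m₂ : e₂ ∈ (⊥ ⊔ ℝ ∙ e₁) ⊔ ℝ ∙ e₂ ⊔ ℝ ∙ e₃ := Submodule.mem_sup_left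
    (Submodule.mem_sup_right (Submodule.mem_span_singleton_self _))
  have m₃ : e₃ ∈ (⊥ ⊔ ℝ ∙ e₁) ⊔ ℝ ∙ e₂ ⊔ ℝ ∙ e₃ :=
    Submodule.mem_sup_right (Submodule.mem_span_singleton_self _)
  have r₁ := h _ m₁
  have r₂ := h _ m₂
  have r₃ := h _ m₃
  rw [bot_sup_eq] at hs
  obtain ⟨s₁, hs₁, s₂, hs₂, rfl⟩ := Submodule.mem_sup.1 hs
  obtain ⟨s₃, hs₃, s₄, hs₄, rfl⟩ := Submodule.mem_sup.1 hs₁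
  obtain ⟨a, rfl⟩ := Submodule.mem_span_singleton.1 hs₃
  obtain ⟨b, rfl⟩ := Submodule.mem_span_singleton.1 hs₄
  obtain ⟨c, rfl⟩ := Submodule.mem_span_singleton.1 hs₂
  exact ⟨a, b, c, r₁, r₂, r₃⟩

end Projection

/-! ### Gauss representations of closed curves -/

section GaussRepresentation

variable {γ : ℝ → ℂ}

theorem IsClosedCurve.continuous_curvature {T : ℝ} (h : IsClosedCurve γ T) :
    Continuous (curvature γ) := by
  have h1 : ContDiff ℝ 1 (deriv γ) := ((contDiff_succ_iff_deriv (n := 1)).1 h.contDiff).2.2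
  have h2 : Continuous (deriv (deriv γ)) := h1.continuous_deriv le_rfl
  have h3 := h1.continuous
  unfold curvature
  simp only [h.unit_speed, one_pow, div_one]
  fun_prop

theorem IsClosedCurve.periodic_curvature {T : ℝ} (h : IsClosedCurve γ T) :
    Function.Periodic (curvature γ) T := by
  have hd : ∀ {f : ℝ → ℂ}, Function.Periodic f T → Function.Periodic (deriv f) T := fun hf t => by
    rw [← deriv_comp_add_const, funext hf]
  intro t
  rw [curvature, curvature, hd h.periodic, hd (hd h.periodic)]

/-- Differentiating `|γ'|² = 1` shows that `γ''` is orthogonal to `γ'`. -/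
theorem IsClosedCurve.deriv_deriv {T : ℝ} (h : IsClosedCurve γ T) (t : ℝ) :
    deriv (deriv γ) t = curvature γ t * Complex.I * deriv γ t := by
  have h1 : ContDiff ℝ 1 (deriv γ) := ((contDiff_succ_iff_deriv (n := 1)).1 h.contDiff).2.2
  have hd := (h1.differentiable (by norm_num) t).hasDerivAt
  have hc : HasDerivAt (fun t => conj (deriv γ t)) (conj (deriv (deriv γ) t)) t :=
    Complex.conjCLE.toContinuousLinearMap.hasFDerivAt.comp_hasDerivAt t hd
  have hconst : (fun t => conj (deriv γ t) * deriv γ t) = fun _ => 1 :=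
    funext fun t => conj_mul_self_of_norm_eq_one (h.unit_speed t)
  have h2 := hc.mul hd
  have h3 := h2.unique ((hasDerivAt_const t (1 : ℂ)).congr_of_eventuallyEq
    (Filter.Eventually.of_forall fun s => congrFun hconst s))
  have hre : (conj (deriv γ t) * deriv (deriv γ) t).re = 0 := by
    have := congrArg Complex.re h3
    simp only [Complex.add_re, Complex.mul_re, Complex.conj_re, Complex.conj_im,
      Complex.zero_re] at this ⊢
    linarith
  have h4 : conj (deriv γ t) * deriv (deriv γ) t = curvature γ t * Complex.I := by
    rw [curvature, h.unit_speed, one_pow, div_one]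
    apply Complex.ext
    · simpa using hre
    · simp
  have h5 := conj_mul_self_of_norm_eq_one (h.unit_speed t)
  rw [← h4]
  linear_combination (-deriv (deriv γ) t) * h5

/-- Closed curves have Gauss representations. -/
theorem IsClosedCurve.exists_gauss {T : ℝ} (h : IsClosedCurve γ T) :
    ∃ α : ℝ → ℝ, ContDiff ℝ 1 α ∧ (∀ t, HasDerivAt γ (Complex.exp (α t * Complex.I)) t) ∧
      ∃ k : ℤ, ∀ t, α (t + T) = α t + k * (2 * Real.pi) := by
  have hκ := h.continuous_curvature
  set α : ℝ → ℝ := fun t => (deriv γ 0).arg + ∫ s in (0 : ℝ)..t, curvature γ s with hα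
  have hd : ∀ t, HasDerivAt α (curvature γ t) t := fun t =>
    (hκ.integral_hasStrictDerivAt 0 t).hasDerivAt.const_add _
  have h1 : ContDiff ℝ 1 (deriv γ) := ((contDiff_succ_iff_deriv (n := 1)).1 h.contDiff).2.2
  have hexp : ∀ t, deriv γ t = Complex.exp (α t * Complex.I) := by
    -- The angle is the integrated curvature, so `γ' exp (-iα)` is constant.
    have hq : ∀ t, HasDerivAt (fun t => deriv γ t * Complex.exp ((-α t : ℝ) * Complex.I)) 0 t := by
      intro t
      have := ((h1.differentiable (by norm_num) t).hasDerivAt).mul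
        (hasDerivAt_exp_mul_I (hd t).neg)
      convert! this using 1
      rw [h.deriv_deriv]
      push_cast
      simp only [Pi.neg_apply]
      ring
    intro t
    have h2 : deriv γ t * Complex.exp ((-α t : ℝ) * Complex.I) =
        deriv γ 0 * Complex.exp ((-α 0 : ℝ) * Complex.I) :=
      is_const_of_deriv_eq_zero (fun s => (hq s).differentiableAt) (fun s => (hq s).deriv) t 0
    have h3 : Complex.exp (α 0 * Complex.I) = deriv γ 0 := by
      have := Complex.norm_mul_exp_arg_mul_I (deriv γ 0)
      rw [h.unit_speed, Complex.ofReal_one, one_mul] at this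
      rw [← this]
      simp [hα, this]
    have h4 : ∀ x : ℝ, Complex.exp ((-x : ℝ) * Complex.I) * Complex.exp (x * Complex.I) = 1 :=
      fun x => by rw [← Complex.exp_add]; simp
    rw [← h3, mul_comm (Complex.exp _), h4] at h2
    linear_combination Complex.exp (α t * Complex.I) * h2 - deriv γ t * h4 (α t)
  refine ⟨α, ?_, fun t => ?_, ?_⟩
  · rw [contDiff_one_iff_deriv]
    refine ⟨fun t => (hd t).differentiableAt, ?_⟩
    rwa [show deriv α = curvature γ from funext fun t => (hd t).deriv]
  · rw [← hexp]
    exact (h.contDiff.differentiable (by norm_num) t).hasDerivAt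
  · have hper : deriv γ T = deriv γ 0 := by
      rw [← zero_add T, ← deriv_comp_add_const, funext h.periodic]
    rw [hexp, hexp] at hper
    obtain ⟨k, hk⟩ := Complex.exp_eq_exp_iff_exists_int.1 hper
    refine ⟨k, fun t => ?_⟩
    have hT : α T = α 0 + k * (2 * Real.pi) := by
      have h2 : (α T : ℂ) * Complex.I = ((α 0 + k * (2 * Real.pi) : ℝ) : ℂ) * Complex.I := by
        rw [hk]; push_cast; ring
      exact_mod_cast mul_right_cancel₀ Complex.I_ne_zero h2
    -- The curvature is periodic, so the increment of `α` over a period does not depend on the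
    -- starting time.
    have hq : ∀ t, HasDerivAt (fun t => α (t + T) - α t) 0 t := fun t => by
      have := ((hd (t + T)).comp_add_const t T).sub (hd t)
      rwa [h.periodic_curvature, sub_self] at this
    have h5 : α (t + T) - α t = α (0 + T) - α 0 :=
      is_const_of_deriv_eq_zero (fun s => (hq s).differentiableAt) (fun s => (hq s).deriv) t 0
    rw [zero_add, hT] at h5
    linarith

end GaussRepresentation

/-! ### First variation and the Euler-Lagrange equation -/

section Variation

variable {α η : ℝ → ℝ}

/-- The linear form giving the change of the angle at time `t` under the parameters `(h, w)`:
`h` moves the angle along `η`, and `w` along `cos α` and `sin α`. -/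
def angleForm (α η : ℝ → ℝ) (t : ℝ) : ℝ × ℂ →L[ℝ] ℝ :=
  η t • ContinuousLinearMap.fst ℝ ℝ ℂ +
    Real.cos (α t) • Complex.reCLM ∘L ContinuousLinearMap.snd ℝ ℝ ℂ +
    Real.sin (α t) • Complex.imCLM ∘L ContinuousLinearMap.snd ℝ ℝ ℂ

theorem angleForm_apply (α η : ℝ → ℝ) (t : ℝ) (v : ℝ × ℂ) :
    angleForm α η t v = η t * v.1 + Real.cos (α t) * v.2.re + Real.sin (α t) * v.2.im := by
  simp [angleForm]

/-- The derivative of `angleForm` in time. -/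
def angleFormDeriv (α η : ℝ → ℝ) (t : ℝ) : ℝ × ℂ →L[ℝ] ℝ :=
  deriv η t • ContinuousLinearMap.fst ℝ ℝ ℂ +
    (-Real.sin (α t) * deriv α t) • Complex.reCLM ∘L ContinuousLinearMap.snd ℝ ℝ ℂ +
    (Real.cos (α t) * deriv α t) • Complex.imCLM ∘L ContinuousLinearMap.snd ℝ ℝ ℂ

theorem continuous_angleForm (hα : ContDiff ℝ 1 α) (hη : ContDiff ℝ 1 η) :
    Continuous (angleForm α η) := by
  have := hα.continuous
  have := hη.continuous
  unfold angleForm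
  fun_prop

theorem continuous_angleFormDeriv (hα : ContDiff ℝ 1 α) (hη : ContDiff ℝ 1 η) :
    Continuous (angleFormDeriv α η) := by
  have := hα.continuous
  have := hα.continuous_deriv le_rfl
  have := hη.continuous_deriv le_rfl
  unfold angleFormDeriv
  fun_prop

/-- The family of perturbed angles. -/
def angleFamily (α η : ℝ → ℝ) (v : ℝ × ℂ) (t : ℝ) : ℝ := α t + angleForm α η t v

/-- The angular velocities of the family of perturbed angles. -/
def angleVelocity (α η : ℝ → ℝ) (v : ℝ × ℂ) (t : ℝ) : ℝ := deriv α t + angleFormDeriv α η t v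

theorem hasDerivAt_angleFamily (hα : ContDiff ℝ 1 α) (hη : ContDiff ℝ 1 η) (v : ℝ × ℂ) (t : ℝ) :
    HasDerivAt (angleFamily α η v) (angleVelocity α η v t) t := by
  have h1 := (hα.differentiable (by norm_num) t).hasDerivAt
  have h2 := (hη.differentiable (by norm_num) t).hasDerivAt
  have := h1.add (((h2.mul_const v.1).add (h1.cos.mul_const v.2.re)).add
    (h1.sin.mul_const v.2.im))
  exact this

theorem isDerivFamily_angleFamily (hα : ContDiff ℝ 1 α) (hη : ContDiff ℝ 1 η) :
    IsDerivFamily (angleFamily α η) fun _ t => angleForm α η t :=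
  isDerivFamily_affine hα.continuous (continuous_angleForm hα hη)

theorem isDerivFamily_angleVelocity (hα : ContDiff ℝ 1 α) (hη : ContDiff ℝ 1 η) :
    IsDerivFamily (angleVelocity α η) fun _ t => angleFormDeriv α η t :=
  isDerivFamily_affine (hα.continuous_deriv le_rfl) (continuous_angleFormDeriv hα hη)

theorem contDiff_angleFamily (hα : ContDiff ℝ 1 α) (hη : ContDiff ℝ 1 η) (v : ℝ × ℂ) :
    ContDiff ℝ 1 (angleFamily α η v) := by
  rw [contDiff_one_iff_deriv]
  refine ⟨fun t => (hasDerivAt_angleFamily hα hη v t).differentiableAt, ?_⟩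
  rw [show deriv (angleFamily α η v) = angleVelocity α η v from
    funext fun t => (hasDerivAt_angleFamily hα hη v t).deriv]
  exact (isDerivFamily_angleVelocity hα hη).continuous.comp (Continuous.prodMk_right v)

theorem angleFamily_zero (α η : ℝ → ℝ) : angleFamily α η 0 = α := by
  funext t; simp [angleFamily]

/-- The tangents of the perturbed curves. -/
def tangentFamily (α η : ℝ → ℝ) (v : ℝ × ℂ) (t : ℝ) : ℂ :=
  Complex.exp (angleFamily α η v t * Complex.I)

/-- The derivative of `tangentFamily` in the parameters. -/
def tangentForm (α η : ℝ → ℝ) (v : ℝ × ℂ) (t : ℝ) : ℝ × ℂ →L[ℝ] ℂ :=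
  (angleForm α η t).smulRight (Complex.I * tangentFamily α η v t)

theorem isDerivFamily_tangentFamily (hα : ContDiff ℝ 1 α) (hη : ContDiff ℝ 1 η) :
    IsDerivFamily (tangentFamily α η) (tangentForm α η) :=
  (isDerivFamily_angleFamily hα hη).exp_mul_I

/-- The perturbed curves, translated to start at the origin. -/
def curveFamily (α η : ℝ → ℝ) (v : ℝ × ℂ) (b : ℝ) : ℂ :=
  ∫ t in (0 : ℝ)..b, tangentFamily α η v t

theorem hasDerivAt_curveFamily (hα : ContDiff ℝ 1 α) (hη : ContDiff ℝ 1 η) (v : ℝ × ℂ) (t : ℝ) :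
    HasDerivAt (curveFamily α η v) (tangentFamily α η v t) t :=
  (((isDerivFamily_tangentFamily hα hη).continuous.comp
    (Continuous.prodMk_right v)).integral_hasStrictDerivAt 0 t).hasDerivAt

theorem integral_exp_eq {f : ℝ → ℝ} (hα : Continuous α) (hf : Continuous f) :
    ∫ t in (0 : ℝ)..(2 * Real.pi), (f t : ℂ) * (Complex.I * Complex.exp (α t * Complex.I)) =
      ⟨-∫ t in (0 : ℝ)..(2 * Real.pi), f t * Real.sin (α t),
        ∫ t in (0 : ℝ)..(2 * Real.pi), f t * Real.cos (α t)⟩ := by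
  rw [Complex.mk_eq_add_mul_I, ← intervalIntegral.integral_neg,
    ← intervalIntegral.integral_ofReal, ← intervalIntegral.integral_ofReal,
    ← intervalIntegral.integral_mul_const, ← intervalIntegral.integral_add
      ((by fun_prop : Continuous fun t => ((-(f t * Real.sin (α t)) : ℝ) : ℂ)).intervalIntegrable
        _ _)
      ((by fun_prop : Continuous fun t =>
        ((f t * Real.cos (α t) : ℝ) : ℂ) * Complex.I).intervalIntegrable _ _)]
  refine intervalIntegral.integral_congr fun t _ => ?_
  simp only [← cos_add_sin_mul_I_eq_exp]
  push_cast
  linear_combination (f t * Complex.sin (α t) : ℂ) * Complex.I_sq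

/-- Nondegeneracy of the Gram matrix of `cos α` and `sin α`, needed for the implicit function
theorem. A null vector `w` gives `∫ ρ² = 0`, so `ρ = 0`; if `w ≠ 0` the angle would be constant over
the period and the curve could not close. -/
theorem eq_zero_of_integral_angle_eq_zero (hα : ContDiff ℝ 1 α) (hc : ClosesUp α) {w : ℂ}
    (hcos : ∫ t in (0 : ℝ)..(2 * Real.pi),
      (Real.cos (α t) * w.re + Real.sin (α t) * w.im) * Real.cos (α t) = 0)
    (hsin : ∫ t in (0 : ℝ)..(2 * Real.pi),
      (Real.cos (α t) * w.re + Real.sin (α t) * w.im) * Real.sin (α t) = 0) : w = 0 := by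
  have hp := Real.pi_pos
  have hcont := hα.continuous
  set ρ : ℝ → ℝ := fun t => Real.cos (α t) * w.re + Real.sin (α t) * w.im with hρ
  have hρc : Continuous ρ := by fun_prop
  have h1 : ∫ t in (0 : ℝ)..(2 * Real.pi), ρ t * ρ t = 0 := by
    have : ∀ t, ρ t * ρ t = ρ t * Real.cos (α t) * w.re + ρ t * Real.sin (α t) * w.im := fun t => by
      simp only [hρ]; ring
    simp only [this]
    rw [intervalIntegral.integral_add
      ((by fun_prop : Continuous fun t => ρ t * Real.cos (α t) * w.re).intervalIntegrable _ _)
      ((by fun_prop : Continuous fun t => ρ t * Real.sin (α t) * w.im).intervalIntegrable _ _),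
      intervalIntegral.integral_mul_const, intervalIntegral.integral_mul_const, hcos, hsin]
    simp
  have h2 := eq_zero_of_integral_mul_self_eq_zero hρc h1
  by_contra hw
  have hd : ∀ t, HasDerivAt α (deriv α t) t := fun t =>
    (hα.differentiable (by norm_num) t).hasDerivAt
  have h3 : ∀ t ∈ Ioo 0 (2 * Real.pi), deriv α t = 0 := fun t ht => by
    have e1 : HasDerivAt ρ 0 t := (hasDerivAt_const t (0 : ℝ)).congr_of_eventuallyEq (by
      filter_upwards [Ioo_mem_nhds ht.1 ht.2] with s hs using h2 s (Ioo_subset_Icc_self hs))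
    have e2 := e1.unique (((hd t).cos.mul_const w.re).add ((hd t).sin.mul_const w.im))
    -- `ρ` and the first factor here are the coordinates of `w` in a rotated frame; both vanish only
    -- for `w = 0`.
    have e3 : (Real.cos (α t) * w.im - Real.sin (α t) * w.re) * deriv α t = 0 := by linarith
    refine (mul_eq_zero.1 e3).resolve_left fun e4 => hw ?_
    have e5 : Real.cos (α t) * w.re + Real.sin (α t) * w.im = 0 := h2 t (Ioo_subset_Icc_self ht)
    have e6 := Real.sin_sq_add_cos_sq (α t)
    apply Complex.ext
    · simp only [Complex.zero_re]
      linear_combination Real.cos (α t) * e5 - Real.sin (α t) * e4 - w.re * e6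
    · simp only [Complex.zero_im]
      linear_combination Real.sin (α t) * e5 + Real.cos (α t) * e4 - w.im * e6
  have h4 : ∀ t ∈ Icc 0 (2 * Real.pi), α t = α 0 := fun t ht => by
    rcases ht.1.eq_or_lt with rfl | h0
    · rfl
    · obtain ⟨c, hc, h⟩ := exists_hasDerivAt_eq_slope α _ h0 hcont.continuousOn fun x _ => hd x
      rw [h3 c ⟨hc.1, hc.2.trans_le ht.2⟩, eq_comm, div_eq_zero_iff] at h
      rcases h with h | h <;> linarith
  refine IsEquilibrium.not_closesUp (α := fun _ => α 0) (fun _ => rfl) ⟨?_, ?_, 0, by simp⟩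
  · refine Eq.trans (intervalIntegral.integral_congr fun t ht => ?_) hc.1
    rw [uIcc_of_le (by positivity)] at ht
    simp only [h4 t ht]
  · refine Eq.trans (intervalIntegral.integral_congr fun t ht => ?_) hc.2.1
    rw [uIcc_of_le (by positivity)] at ht
    simp only [h4 t ht]

theorem integral_tangentForm_apply (hα : ContDiff ℝ 1 α) (hη : ContDiff ℝ 1 η) (v : ℝ × ℂ) :
    (∫ t in (0 : ℝ)..(2 * Real.pi), tangentForm α η 0 t) v =
      ⟨-∫ t in (0 : ℝ)..(2 * Real.pi), angleForm α η t v * Real.sin (α t),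
        ∫ t in (0 : ℝ)..(2 * Real.pi), angleForm α η t v * Real.cos (α t)⟩ := by
  have hL : Continuous fun t => angleForm α η t v :=
    (continuous_angleForm hα hη).clm_apply continuous_const
  rw [(isDerivFamily_tangentFamily hα hη).integral_apply, ← integral_exp_eq hα.continuous hL]
  refine intervalIntegral.integral_congr fun t _ => ?_
  simp [tangentForm, tangentFamily, angleFamily_zero]

/-- Any infinitesimal deformation of the angle that keeps the curve closed to first order is
corrected, to higher order, to a deformation through closed curves. -/
theorem exists_closing_path (hα : ContDiff ℝ 1 α) (hη : ContDiff ℝ 1 η) (hc : ClosesUp α)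
    (hcos : ∫ t in (0 : ℝ)..(2 * Real.pi), η t * Real.cos (α t) = 0)
    (hsin : ∫ t in (0 : ℝ)..(2 * Real.pi), η t * Real.sin (α t) = 0) :
    ∃ (ε : ℝ) (p p' : ℝ → ℝ × ℂ), 0 < ε ∧ p 0 = 0 ∧ p' 0 = (1, 0) ∧
      ContinuousOn p' (Ioo (-ε) ε) ∧ (∀ h ∈ Ioo (-ε) ε, HasDerivAt p (p' h) h) ∧
      ∀ h ∈ Ioo (-ε) ε, curveFamily α η (p h) (2 * Real.pi) = 0 := by
  have hfam := (isDerivFamily_tangentFamily hα hη).integral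
  set G : ℝ × ℂ → ℂ := fun v => curveFamily α η v (2 * Real.pi) with hG
  have hG1 : ContDiff ℝ 1 G := hfam.contDiff (2 * Real.pi)
  have hGd : fderiv ℝ G 0 = ∫ t in (0 : ℝ)..(2 * Real.pi), tangentForm α η 0 t :=
    (hfam.hasFDerivAt 0 (2 * Real.pi)).fderiv
  have hG0 : G 0 = 0 := by
    rw [← curveOf_two_pi_eq_zero hα.continuous hc]
    simp only [hG, curveFamily, curveOf, tangentFamily, angleFamily_zero, cos_add_sin_mul_I_eq_exp]
  have hinj : Function.Injective (fderiv ℝ G 0 ∘L .inr ℝ ℝ ℂ) := by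
    rw [injective_iff_map_eq_zero]
    intro w hw
    rw [ContinuousLinearMap.comp_apply, hGd, integral_tangentForm_apply hα hη] at hw
    refine eq_zero_of_integral_angle_eq_zero hα hc ?_ ?_
    · simpa [angleForm_apply] using congrArg Complex.im hw
    · simpa [angleForm_apply] using congrArg Complex.re hw
  -- An injective endomorphism of a finite-dimensional space is invertible, so the two closing
  -- equations can be solved for `w`.
  have hinv : (fderiv ℝ G 0 ∘L .inr ℝ ℝ ℂ).IsInvertible := by
    refine ⟨(LinearEquiv.ofInjectiveEndo
      (fderiv ℝ G 0 ∘L .inr ℝ ℝ ℂ : ℂ →L[ℝ] ℂ).toLinearMap hinj).toContinuousLinearEquiv, ?_⟩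
    rfl
  have hdir : fderiv ℝ G 0 (1, 0) = 0 := by
    rw [hGd, integral_tangentForm_apply hα hη]
    simp [angleForm_apply, hcos, hsin, Complex.ext_iff]
  set ψ : ℝ → ℂ := hG1.contDiffAt.implicitFunction one_ne_zero hinv with hψ
  have hψ0 : ψ 0 = 0 := hG1.contDiffAt.implicitFunction_apply_self one_ne_zero hinv
  have hψc : ContDiffAt ℝ 1 ψ 0 := hG1.contDiffAt.contDiffAt_implicitFunction one_ne_zero hinv
  have hψG : ∀ᶠ h in nhds (0 : ℝ), G (h, ψ h) = G 0 :=
    hG1.contDiffAt.eventually_apply_implicitFunction one_ne_zero hinv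
  -- Since `η` preserves closedness to first order, the correction has zero velocity and the path
  -- starts in direction `(1, 0)`.
  have hψ' : deriv ψ 0 = 0 := by
    have := (hG1.contDiffAt.hasStrictFDerivAt_implicitFunction one_ne_zero
      hinv).hasFDerivAt.hasDerivAt.deriv
    rw [hψ]
    refine this.trans ?_
    simp [hdir]
  obtain ⟨ε, hε, hball⟩ := Metric.eventually_nhds_iff.1
    ((hψc.eventually (by simp)).and hψG)
  have hmem : ∀ h ∈ Ioo (-ε) ε, ContDiffAt ℝ 1 ψ h ∧ G (h, ψ h) = G 0 := fun h hh =>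
    hball (by rw [Real.dist_eq, sub_zero, abs_lt]; exact hh)
  refine ⟨ε, fun h => (h, ψ h), fun h => (1, deriv ψ h), hε, by simp [hψ0], by simp [hψ'], ?_, ?_,
    fun h hh => (hmem h hh).2.trans hG0⟩
  · have hon : ContDiffOn ℝ 1 ψ (Ioo (-ε) ε) := fun h hh => (hmem h hh).1.contDiffWithinAt
    exact continuousOn_const.prodMk (hon.continuousOn_deriv_of_isOpen isOpen_Ioo le_rfl)
  · intro h hh
    exact (hasDerivAt_id h).prodMk
      ((hmem h hh).1.differentiableAt (by norm_num)).hasDerivAt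

variable {γ : ℝ → ℂ} {k : ℤ}

theorem closesUp_of_periodic (hα : Continuous α)
    (hγ : ∀ t, HasDerivAt γ (Complex.exp (α t * Complex.I)) t)
    (hclose : γ (2 * Real.pi) = γ 0) (hper : ∀ t, α (t + 2 * Real.pi) = α t + k * (2 * Real.pi)) :
    ClosesUp α := by
  have h1 : ∫ t in (0 : ℝ)..(2 * Real.pi), (1 : ℝ) * Complex.exp (α t * Complex.I) = 0 := by
    have := intervalIntegral.integral_eq_sub_of_hasDerivAt (a := 0) (b := 2 * Real.pi)
      (fun t _ => hγ t)
      ((by fun_prop : Continuous fun t => Complex.exp (α t * Complex.I)).intervalIntegrable _ _)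
    simpa [hclose] using this
  have h2 := integral_exp_eq (f := fun _ => 1) hα continuous_const
  have h3 : ∫ t in (0 : ℝ)..(2 * Real.pi),
      ((1 : ℝ) : ℂ) * (Complex.I * Complex.exp (α t * Complex.I)) = 0 := by
    simp only [mul_left_comm _ Complex.I]
    rw [intervalIntegral.integral_const_mul, h1, mul_zero]
  rw [h3] at h2
  refine ⟨?_, ?_, k, ?_⟩
  · simpa using (congrArg Complex.im h2).symm
  · simpa using (congrArg Complex.re h2).symm
  · have := hper 0
    rw [zero_add] at this
    rw [this]; ring

/-- The first variation of the elastic energy vanishes in all directions that keep the curve closed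
to first order. -/
theorem IsCritical.integral_eq_zero (hcrit : IsCritical (fun x => x ^ 2) γ)
    (hα : ContDiff ℝ 1 α) (hγ : ∀ t, HasDerivAt γ (Complex.exp (α t * Complex.I)) t)
    (hper : ∀ t, α (t + 2 * Real.pi) = α t + k * (2 * Real.pi))
    (hη : ContDiff ℝ 1 η) (hηper : Function.Periodic η (2 * Real.pi))
    (hcos : ∫ t in (0 : ℝ)..(2 * Real.pi), η t * Real.cos (α t) = 0)
    (hsin : ∫ t in (0 : ℝ)..(2 * Real.pi), η t * Real.sin (α t) = 0) :
    ∫ t in (0 : ℝ)..(2 * Real.pi), deriv α t * deriv η t = 0 := by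
  have hclose : γ (2 * Real.pi) = γ 0 := by simpa using hcrit.1.periodic 0
  obtain ⟨ε, p, p', hε, hp0, hp'0, hp'c, hp', hpG⟩ := exists_closing_path hα hη
    (closesUp_of_periodic hα.continuous hγ hclose hper) hcos hsin
  have hV := isDerivFamily_angleVelocity hα hη
  have hP := isDerivFamily_tangentFamily hα hη
  set Γ : ℝ → ℝ → ℂ := fun h t => γ 0 + curveFamily α η (p h) t with hΓ
  have hΓd : ∀ h t, HasDerivAt (Γ h) (tangentFamily α η (p h) t) t := fun h t =>
    (hasDerivAt_curveFamily hα hη (p h) t).const_add _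
  have hΓd' : ∀ h t, HasDerivAt (Γ h)
      (1 * Complex.exp (angleFamily α η (p h) t * Complex.I)) t := fun h t => by
    rw [one_mul]; exact hΓd h t
  have hAd := fun h => contDiff_angleFamily hα hη (p h)
  have hAper : ∀ v t, angleFamily α η v (t + 2 * Real.pi) =
      angleFamily α η v t + k * (2 * Real.pi) := fun v t => by
    simp only [angleFamily, angleForm_apply, hper, hηper t, Real.cos_add_int_mul_two_pi,
      Real.sin_add_int_mul_two_pi]
    ring
  have hPper : ∀ v t, tangentFamily α η v (t + 2 * Real.pi) = tangentFamily α η v t := fun v t => by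
    rw [tangentFamily, tangentFamily, ← cos_add_sin_mul_I_eq_exp, hAper,
      Real.cos_add_int_mul_two_pi, Real.sin_add_int_mul_two_pi, cos_add_sin_mul_I_eq_exp]
  have hvar : IsVariation γ ε Γ := by
    refine ⟨hε, ?_, fun h hh => ?_, fun j hj => ?_⟩
    · funext t
      rw [eq_const_add_of_hasDerivAt hγ
        (v := fun t => Complex.exp (α t * Complex.I)) (δ := curveFamily α η 0) (fun t => by
          have := hasDerivAt_curveFamily hα hη 0 t
          rwa [tangentFamily, angleFamily_zero] at this) t]
      simp [hΓ, hp0, curveFamily]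
    · refine isClosedCurve_of_tangent (by positivity) norm_one (hAd h) (hΓd' h) fun t => ?_
      have h1 := eq_const_add_of_hasDerivAt (γ := fun t => Γ h (t + 2 * Real.pi))
        (fun t => by
          have := (hΓd h (t + 2 * Real.pi)).comp_add_const t (2 * Real.pi)
          rwa [hPper] at this) (hΓd h) t
      simp only [hΓ, zero_add, hpG h hh] at h1 ⊢
      rw [h1]
      simp [curveFamily]
    · have hj0 : ∀ h, iteratedDeriv 0 (Γ h) = Γ h := fun h => iteratedDeriv_zero
      have hj1 : ∀ h, iteratedDeriv 1 (Γ h) = tangentFamily α η (p h) := fun h => by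
        rw [iteratedDeriv_one]; exact funext fun t => (hΓd h t).deriv
      have hj2 : ∀ h, iteratedDeriv 2 (Γ h) = fun t =>
          Complex.I * Complex.ofRealCLM (angleVelocity α η (p h) t) *
            tangentFamily α η (p h) t := fun h => by
        rw [iteratedDeriv_succ, hj1]
        exact funext fun t =>
          (hasDerivAt_exp_mul_I (hasDerivAt_angleFamily hα hη (p h) t)).deriv
      interval_cases j
      · simp only [hj0]
        obtain ⟨D, hD, hD'⟩ := hP.integral.exists_deriv_along hp' hp'c
        exact ⟨D, hD, fun h hh t => (hD' h hh t).const_add (γ 0)⟩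
      · simp only [hj1]
        exact hP.exists_deriv_along hp' hp'c
      · simp only [hj2]
        exact (((hV.clm_comp Complex.ofRealCLM).clm_comp
          (ContinuousLinearMap.mul ℝ ℂ Complex.I)).mul hP).exists_deriv_along hp' hp'c
  have hU : ∀ h, uniformization (fun x => x ^ 2) (Γ h) =
      ∫ t in (0 : ℝ)..(2 * Real.pi), angleVelocity α η (p h) t * angleVelocity α η (p h) t :=
    fun h => by
      refine intervalIntegral.integral_congr fun t _ => ?_
      simp only [curvature_of_tangent norm_one (hAd h) (hΓd' h),
        (hasDerivAt_angleFamily hα hη (p h) t).deriv, sq]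
  have hVV := hV.mul hV
  have h0 : (0 : ℝ) ∈ Ioo (-ε) ε := ⟨neg_lt_zero.2 hε, hε⟩
  have hUd := (hVV.hasFDerivAt_integral (p 0) (2 * Real.pi)).comp_hasDerivAt 0 (hp' 0 h0)
  have hcr := hcrit.2 ε Γ hvar
  simp only [hU] at hcr
  have hzero := hUd.unique hcr
  rw [hVV.integral_apply, hp'0, hp0] at hzero
  -- The energy is the integral of the squared angular velocity; this is its derivative in direction
  -- `(1, 0)`.
  have h2 : ∫ t in (0 : ℝ)..(2 * Real.pi), 2 * (deriv α t * deriv η t) = 0 := by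
    refine Eq.trans (intervalIntegral.integral_congr fun t _ => ?_) hzero
    simp [angleVelocity, angleFormDeriv]
    ring
  rw [intervalIntegral.integral_const_mul] at h2
  linarith

/-- The Euler-Lagrange equation: the curvature of a critical curve is an affine function of the
position. -/
theorem IsCritical.exists_curvature_eq (hcrit : IsCritical (fun x => x ^ 2) γ)
    (hα : ContDiff ℝ 1 α) (hγ : ∀ t, HasDerivAt γ (Complex.exp (α t * Complex.I)) t)
    (hper : ∀ t, α (t + 2 * Real.pi) = α t + k * (2 * Real.pi)) :
    ∃ a b c : ℝ, ∀ t, deriv α t = a + b * (γ t).re + c * (γ t).im := by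
  have hp := Real.pi_pos
  have hγc : Continuous γ := continuous_iff_continuousAt.2 fun t => (hγ t).continuousAt
  have hre : ∀ t, HasDerivAt (fun t => (γ t).re) (Real.cos (α t)) t := fun t => by
    have := Complex.reCLM.hasFDerivAt.comp_hasDerivAt t (hγ t)
    rwa [← cos_add_sin_mul_I_eq_exp, show Complex.reCLM _ = Real.cos (α t) by
      simp [Complex.cos_ofReal_re]] at this
  have him : ∀ t, HasDerivAt (fun t => (γ t).im) (Real.sin (α t)) t := fun t => by
    have := Complex.imCLM.hasFDerivAt.comp_hasDerivAt t (hγ t)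
    rwa [← cos_add_sin_mul_I_eq_exp, show Complex.imCLM _ = Real.sin (α t) by
      simp [Complex.sin_ofReal_re]] at this
  have hκc : Continuous (deriv α) := hα.continuous_deriv le_rfl
  have hκper : Function.Periodic (deriv α) (2 * Real.pi) := fun t => by
    rw [← deriv_comp_add_const, funext hper, deriv_add_const]
  -- The coefficients come from projecting `α'` onto the span of `1`, `x`, `y`; it remains to show
  -- that the residue `ζ` vanishes.
  obtain ⟨a, b, c, h1, h2, h3⟩ := exists_orthogonal_three ⟨deriv α, hκc⟩ 1
    ⟨fun t => (γ t).re, by fun_prop⟩ ⟨fun t => (γ t).im, by fun_prop⟩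
  simp only [periodInner_apply, ContinuousMap.sub_apply, ContinuousMap.add_apply,
    ContinuousMap.smul_apply, ContinuousMap.coe_mk, ContinuousMap.one_apply, smul_eq_mul,
    mul_one] at h1 h2 h3
  set ζ : ℝ → ℝ := fun t => deriv α t - (a + b * (γ t).re + c * (γ t).im) with hζ
  have hζc : Continuous ζ := by fun_prop
  have hζper : Function.Periodic ζ (2 * Real.pi) := fun t => by
    simp only [hζ, hκper t, hcrit.1.periodic t]
  have h1' : ∫ t in (0 : ℝ)..(2 * Real.pi), ζ t = 0 := h1
  have h2' : ∫ t in (0 : ℝ)..(2 * Real.pi), ζ t * (γ t).re = 0 := h2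
  have h3' : ∫ t in (0 : ℝ)..(2 * Real.pi), ζ t * (γ t).im = 0 := h3
  -- Orthogonality of `ζ` to `1` makes its primitive periodic; orthogonality to `x` and `y` makes it
  -- admissible after integration by parts.
  set η : ℝ → ℝ := fun t => ∫ s in (0 : ℝ)..t, ζ s with hη
  have hηd : ∀ t, HasDerivAt η (ζ t) t := fun t => (hζc.integral_hasStrictDerivAt 0 t).hasDerivAt
  have hηd' : deriv η = ζ := funext fun t => (hηd t).deriv
  have hη1 : ContDiff ℝ 1 η := by
    rw [contDiff_one_iff_deriv, hηd']
    exact ⟨fun t => (hηd t).differentiableAt, hζc⟩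
  have hη0 : η 0 = 0 := by simp [hη]
  have hη2 : η (2 * Real.pi) = 0 := h1'
  have hηper : Function.Periodic η (2 * Real.pi) := fun t => by
    have := hζper.intervalIntegral_add_eq t 0
    rw [zero_add, h1'] at this
    have h4 := intervalIntegral.integral_add_adjacent_intervals
      (hζc.intervalIntegrable (μ := MeasureTheory.volume) 0 t)
      (hζc.intervalIntegrable t (t + 2 * Real.pi))
    simp only [hη]
    rw [← h4, this, add_zero]
  have hparts : ∀ {f f' : ℝ → ℝ}, (∀ t, HasDerivAt f (f' t) t) → Continuous f' →
      ∫ t in (0 : ℝ)..(2 * Real.pi), ζ t * f t = 0 →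
      ∫ t in (0 : ℝ)..(2 * Real.pi), η t * f' t = 0 := fun hf hf' h => by
    rw [intervalIntegral.integral_mul_deriv_eq_deriv_mul (fun t _ => hηd t) (fun t _ => hf t)
      (hζc.intervalIntegrable _ _) (hf'.intervalIntegrable _ _), hη0, hη2, h]
    simp
  have hαc := hα.continuous
  have h5 := hcrit.integral_eq_zero hα hγ hper hη1 hηper
    (hparts hre (by fun_prop) h2') (hparts him (by fun_prop) h3')
  rw [hηd'] at h5
  -- `∫ ζ²` is `∫ α' ζ`, zero by criticality, minus products of `ζ` with `1`, `x`, `y`.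
  have h6 : ∫ t in (0 : ℝ)..(2 * Real.pi), ζ t * ζ t = 0 := by
    have e : ∀ t, ζ t * ζ t =
        deriv α t * ζ t - (a * ζ t + b * (ζ t * (γ t).re) + c * (ζ t * (γ t).im)) := fun t => by
      simp only [hζ]; ring
    have i1 : Continuous fun t => deriv α t * ζ t := by fun_prop
    have i2 : Continuous fun t => a * ζ t := by fun_prop
    have i3 : Continuous fun t => b * (ζ t * (γ t).re) := by fun_prop
    have i4 : Continuous fun t => c * (ζ t * (γ t).im) := by fun_prop
    have i5 : Continuous fun t => a * ζ t + b * (ζ t * (γ t).re) := by fun_prop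
    have i6 : Continuous fun t => a * ζ t + b * (ζ t * (γ t).re) + c * (ζ t * (γ t).im) := by
      fun_prop
    simp only [e]
    rw [intervalIntegral.integral_sub (i1.intervalIntegrable _ _) (i6.intervalIntegrable _ _),
      intervalIntegral.integral_add (i5.intervalIntegrable _ _)
        (i4.intervalIntegrable _ _),
      intervalIntegral.integral_add (i2.intervalIntegrable _ _) (i3.intervalIntegrable _ _),
      intervalIntegral.integral_const_mul, intervalIntegral.integral_const_mul,
      intervalIntegral.integral_const_mul, h1', h2', h3', h5]
    simp
  have h7 := eq_zero_of_integral_mul_self_eq_zero hζc h6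
  refine ⟨a, b, c, fun t => ?_⟩
  obtain ⟨s, hs, hst⟩ := hζper.exists_mem_Ico₀ (by positivity) t
  have := h7 s (Ico_subset_Icc_self hs)
  rw [← hst] at this
  exact sub_eq_zero.1 this

/-- Up to a rotation, the Gauss representation of a critical curve is a motion of the pendulum. -/
theorem IsCritical.exists_pendulum (hcrit : IsCritical (fun x => x ^ 2) γ) :
    ∃ (ω θ : ℝ) (α : ℝ → ℝ), 0 ≤ ω ∧ IsPendulum ω α ∧ ClosesUp α ∧
      ∀ t, HasDerivAt (fun t => Complex.exp (θ * Complex.I) * γ t)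
        (Complex.exp (α t * Complex.I)) t := by
  obtain ⟨α, hα, hγ, k, hper⟩ := hcrit.1.exists_gauss
  obtain ⟨a, b, c, hκ⟩ := hcrit.exists_curvature_eq hα hγ hper
  -- With this `z`, `b cos α + c sin α = -‖z‖ sin (α + arg z)`; hence the rotation angle `arg z` and
  -- `ω² = ‖z‖`.
  set z : ℂ := ⟨-c, -b⟩ with hz
  have hrot : ∀ t, HasDerivAt (fun t => Complex.exp (z.arg * Complex.I) * γ t)
      (Complex.exp ((α t + z.arg : ℝ) * Complex.I)) t := fun t => by
    convert! (hγ t).const_mul (Complex.exp (z.arg * Complex.I)) using 1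
    rw [← Complex.exp_add]
    push_cast
    ring_nf
  refine ⟨Real.sqrt ‖z‖, z.arg, fun t => α t + z.arg, Real.sqrt_nonneg _, ?_, ?_, hrot⟩
  · refine .of_hasDerivAt (a := deriv α)
      (fun t => ((hα.differentiable (by norm_num) t).hasDerivAt).add_const _) fun t => ?_
    have h1 : HasDerivAt (deriv α) (b * Real.cos (α t) + c * Real.sin (α t)) t := by
      have hre := Complex.reCLM.hasFDerivAt.comp_hasDerivAt t (hγ t)
      have him := Complex.imCLM.hasFDerivAt.comp_hasDerivAt t (hγ t)
      rw [← cos_add_sin_mul_I_eq_exp] at hre him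
      have := ((hre.const_mul b).const_add a).add (him.const_mul c)
      convert! this using 1
      · funext s
        exact hκ s
      · simp [Complex.cos_ofReal_re, Complex.sin_ofReal_re]
    convert! h1 using 1
    have hs : ‖z‖ * Real.sin z.arg = -b := Complex.norm_mul_sin_arg z
    have hc : ‖z‖ * Real.cos z.arg = -c := Complex.norm_mul_cos_arg z
    rw [Real.sq_sqrt (norm_nonneg z), Real.sin_add]
    linear_combination -Real.cos (α t) * hs - Real.sin (α t) * hc
  · refine closesUp_of_periodic (k := k) (by have := hα.continuous; fun_prop) hrot ?_
      fun t => by rw [hper]; ring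
    have : γ (2 * Real.pi) = γ 0 := by simpa using hcrit.1.periodic 0
    simp only [this]

end Variation

end PlaneCurve

end

open PlaneCurve
theorem theorem1p7 :
    -- critical closed curves: the pendulum equation after a rotation, and the two shapes
    (∀ γ : ℝ → ℂ, IsCritical (fun x => x ^ 2) γ →
      ∃ (ω θ : ℝ) (α : ℝ → ℝ), 0 ≤ ω ∧
        IsGaussRep (fun t => Complex.exp (θ * Complex.I) * γ t) α ∧ IsPendulum ω α ∧
        ((ω = 0 ∧ PassedSeveralTimes IsCircle γ) ∨
          (0 < ω ∧ PassedSeveralTimes IsInfinityShaped γ ∧ IsEllipticSwing ω α))) ∧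
    -- pendulum trajectories over `[0, 2π]` that give closed differentiable curves
    (∀ (ω : ℝ) (α : ℝ → ℝ), 0 ≤ ω → IsPendulum ω α → ClosesUp α →
      (ω = 0 ∧ PassedSeveralTimes IsCircle (curveOf α)) ∨
        (0 < ω ∧ PassedSeveralTimes IsInfinityShaped (curveOf α) ∧ IsEllipticSwing ω α)) ∧
    -- equilibria, separatrices and full rotations give none
    (∀ (ω : ℝ) (α : ℝ → ℝ), 0 < ω → IsPendulum ω α →
      (IsEquilibrium α ∨ IsSeparatrix ω α ∨ IsFullRotation ω α) → ¬ ClosesUp α) := by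
  refine ⟨fun γ hγ => ?_, fun ω α hω h hc => ?_, fun ω α hω h hα =>
    h.not_closesUp_of_not_swing hω hα⟩
  · obtain ⟨ω, θ, α, hω, hα, hc, hrot⟩ := hγ.exists_pendulum
    refine ⟨ω, θ, α, hω, ⟨hα.1.continuous, fun t => ?_⟩, hα, ?_⟩
    · rw [cos_add_sin_mul_I_eq_exp]; exact hrot t
    -- The factor `u = exp (-iθ)` undoes the rotation, so the shape is obtained for `γ` itself.
    · refine hα.shape hω hc (u := Complex.exp ((-θ : ℝ) * Complex.I))
        (Complex.norm_exp_ofReal_mul_I _) fun t => ?_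
      have h1 : Complex.exp ((-θ : ℝ) * Complex.I) * Complex.exp (θ * Complex.I) = 1 := by
        rw [← Complex.exp_add]; simp
      convert! (hrot t).const_mul (Complex.exp ((-θ : ℝ) * Complex.I)) using 1
      funext s
      rw [← mul_assoc, h1, one_mul]
  · refine h.shape hω hc norm_one fun t => ?_
    rw [one_mul]
    exact hasDerivAt_curveOf h.1.continuous t
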